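/- **Definitions.** A *difference–restriction algebra* is a nonempty algebra with two binary operations $-,\rhd$ that is isomorphic to an algebra of partial functions from a set $X$ to a set $Y$, where $f-g=f\setminus g$ and $f\rhd g$ is the restriction of $g$ to $\mathrm{dom}(f)$. Put $a\cdot b:=a-(a-b)$, order the algebra by $a\le b\iff a\cdot b=a$, and call $a,b$ *compatible* if $a\rhd b=b\rhd a$. The algebra is *finitarily compatibly complete* if every finite set of pairwise compatible elements has a join. A *finitary compatible completion* of $A$ is an injective homomorphism $\iota:A\to C$ into a finitarily compatibly complete algebra such that every element of $C$ is the join of a finite subset of $\iota[A]$. $\mathsf{DRA}$ is the category of difference–restriction algebras and homomorphisms. A *Hausdorff étale space* is a surjective local homeomorphism $\pi:X\to X_0$ with $X$ and $X_0$ Hausdorff. A morphism from $\pi$ to $\rho:Y\to Y_0$ in the category $\mathsf{HausEt}$ is a partial function $\varphi:X\rightharpoonup Y$ such that preimages of open sets are open, preimages of compact sets are compact, $\pi(x)=\pi(x')$ implies $\rho(\varphi(x))=\rho(\varphi(x'))$ for $x,x'\in\mathrm{dom}\,\varphi$, $\varphi$ is injective on each fibre of $\pi$, and whenever $x\in\mathrm{dom}\,\varphi$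 and $\rho(y')=\rho(\varphi(x))$ there is $x'$ with $\pi(x')=\pi(x)$ and $\varphi(x')=y'$. The functor $F:\mathsf{DRA}\to\mathsf{HausEt}^{\mathrm{op}}$ sends $A$ to the quotient map from the space of maximal (proper) filters of $A$, with the topology generated by the sets $\widehat a=\{\mu\mid a\in\mu\}$, onto its quotient by the relation $\mu\approx\nu\iff a\rhd b\in\nu$ and $b\rhd a\in\mu$ for all $a\in\mu,b\in\nu$; it sends $h$ to $\xi\mapsto h^{-1}(\xi)$, defined where $h^{-1}(\xi)\neq\emptyset$. The functor $G:\mathsf{HausEt}^{\mathrm{op}}\to\mathsf{DRA}$ sends $\pi$ to the algebra of compact open $U\subseteq X$ with $\pi|_U$ injective, with $U-V=U\setminus V$ and $U\rhd V=\pi^{-1}(\pi(U))\cap V$, and sends $\varphi$ to $U\mapsto\varphi^{-1}(U)$. Let $\sigma$ be a set of operation symbols with finite arities. An $n$-ary operation $\Omega$ on $A$ is a *compatibility preserving operator* if $\Omega(a_1,\dots,a_n)$ and $\Omega(a'_1,\dots,a'_n)$ are compatible whenever $a_i,a_i'$ are compatible for all $i$; its value is $0$ (the least element) if some argument is $0$;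 and in each coordinate, if the join of $b$ and $c$ exists, $\Omega$ sends it to the join of the values at $b$ and $c$. $\mathsf{DRA}(\sigma)$ is the category of difference–restriction algebras with a compatibility preserving operator for each symbol of $\sigma$, and homomorphisms preserving all operations; its finitary compatible completions are defined as above with homomorphisms of $\mathsf{DRA}(\sigma)$. For an $(n+1)$-ary relation $R$ on $X$ put $\Omega_R(S_1,\dots,S_n)=\{y\mid\exists x_i\in S_i: R x_1\dots x_n y\}$. $R$ is *spectral* if $\Omega_R$ sends open sets to open sets and compact open sets to compact open sets; *tight* if $Rx_1\dots x_ny$ holds whenever $y\in\Omega_R(S_1,\dots,S_n)$ for all compact open $S_i\ni x_i$; it has the *compatibility property* if, writing $xCx'$ for "$\pi(x)=\pi(x')\Rightarrow x=x'$", $x_iCx_i'$ for all $i$, $Rx_1\dots x_ny$ and $Rx_1'\dots x_n'y'$ imply $yCy'$. $\mathsf{HausEt}(\sigma)$ is the category of Hausdorff étale spaces with a tight spectral $(n+1)$-ary relation having the compatibility property for each $n$-ary symbol of $\sigma$; its morphisms are the morphisms $\varphi$ of $\mathsf{HausEt}$ such that, for each symbol, (i) if $R_Xx_1\dots x_ny$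 and $\varphi(x_1),\dots,\varphi(x_n)$ are defined, then $\varphi(y)$ is defined and $R_Y\varphi(x_1)\dots\varphi(x_n)\varphi(y)$; (ii) if $\varphi(y)$ is defined and $R_Yy_1\dots y_n\varphi(y)$, there are $x_i$ with $\varphi(x_i)=y_i$ and $R_Xx_1\dots x_ny$. The functors $F':\mathsf{DRA}(\sigma)\to\mathsf{HausEt}(\sigma)^{\mathrm{op}}$ and $G':\mathsf{HausEt}(\sigma)^{\mathrm{op}}\to\mathsf{DRA}(\sigma)$ extend $F$ and $G$: $F'$ equips $F(A)$ with the relations $\mu_1\dots\mu_n\nu$ defined by $\Omega(a_1,\dots,a_n)\in\nu$ for all $a_i\in\mu_i$, and $G'$ equips $G(\pi)$ with the operations $\Omega_R$. **Statement.** 1. The full subcategory of $\mathsf{DRA}$ consisting of the finitarily compatibly complete algebras is reflective. The reflector is $G\circ F$, and for every $A$ the reflection arrow $A\to GF(A)$ is a finitary compatible completion of $A$. 2. The full subcategory of $\mathsf{HausEt}$ consisting of the $\pi:X\to X_0$ with $X$ locally compact and zero-dimensional (every point has a neighbourhood basis of compact sets, and one of clopen sets) is reflective, with reflector $F\circ G$.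 3. For every $\sigma$, the full subcategory of $\mathsf{DRA}(\sigma)$ consisting of the finitarily compatibly complete algebras is reflective. The reflector is $G'\circ F'$, and every reflection arrow is a finitary compatible completion. 4. For every $\sigma$, the full subcategory of $\mathsf{HausEt}(\sigma)$ consisting of the spaces with $X$ locally compact and zero-dimensional is reflective, with reflector $F'\circ G'$. -/

import Mathlib

open CategoryTheory Topology Opposite

universe u w

namespace DiffRestAlg

/-! ### Difference-restriction algebras -/

/-- Algebras of the signature consisting of two binary operations: difference and
(domain) restriction. -/
class DiffRest (A : Type u) where
  /-- difference -/
  diff : A → A → A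
  /-- restriction of the second argument to the domain of the first -/
  rest : A → A → A

infixl:65 " ⊖ " => DiffRest.diff
infixl:70 " ⊳ " => DiffRest.rest

/-- A subset of `X × Y` that is (the graph of) a partial function from `X` to `Y`. -/
def IsPartialFunction {X Y : Type u} (f : Set (X × Y)) : Prop :=
  ∀ x y z, (x, y) ∈ f → (x, z) ∈ f → y = z

/-- Domain restriction of partial functions: `g` restricted to the domain of `f`. -/
def domRestrict {X Y : Type u} (f g : Set (X × Y)) : Set (X × Y) :=
  {p | (∃ y, (p.1, y) ∈ f) ∧ p ∈ g}

/-- `r` is an isomorphism from `A` onto an algebra of partial functions from `X` to `Y`, with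
relative complement and domain restriction as operations. -/
structure IsRepresentation {A : Type u} [DiffRest A] {X Y : Type u} (r : A → Set (X × Y)) :
    Prop where
  injective : Function.Injective r
  isPartialFunction : ∀ a, IsPartialFunction (r a)
  map_diff : ∀ a b, r (a ⊖ b) = r a \ r b
  map_rest : ∀ a b, r (a ⊳ b) = domRestrict (r a) (r b)

/-- Difference-restriction algebras: nonempty algebras isomorphic to an algebra of partial
functions. -/
structure DRA : Type (u + 1) where
  carrier : Type u
  [str : DiffRest carrier]
  nonempty : Nonempty carrier
  representable : ∃ (X Y : Type u) (r : carrier → Set (X × Y)), IsRepresentation r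

instance : CoeSort DRA.{u} (Type u) := ⟨DRA.carrier⟩

attribute [instance] DRA.str

/-- The derived meet operation. -/
def meet {A : Type u} [DiffRest A] (a b : A) : A := a ⊖ (a ⊖ b)

theorem IsRepresentation.map_meet {A : Type u} [DiffRest A] {X Y : Type u}
    {r : A → Set (X × Y)} (hr : IsRepresentation r) (a b : A) : r (meet a b) = r a ∩ r b := by
  simp [meet, hr.map_diff]

theorem IsRepresentation.meet_eq_iff {A : Type u} [DiffRest A] {X Y : Type u}
    {r : A → Set (X × Y)} (hr : IsRepresentation r) (a b : A) : meet a b = a ↔ r a ⊆ r b := by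
  rw [← hr.injective.eq_iff, hr.map_meet, Set.inter_eq_left]

/-- The order of a difference-restriction algebra: `a ≤ b` iff the meet of `a` and `b` is `a`. -/
instance (A : DRA.{u}) : PartialOrder A where
  le a b := meet a b = a
  le_refl a := by
    obtain ⟨X, Y, r, hr⟩ := A.representable
    exact (hr.meet_eq_iff _ _).2 subset_rfl
  le_trans a b c h₁ h₂ := by
    obtain ⟨X, Y, r, hr⟩ := A.representable
    exact (hr.meet_eq_iff _ _).2 (((hr.meet_eq_iff _ _).1 h₁).trans ((hr.meet_eq_iff _ _).1 h₂))
  le_antisymm a b h₁ h₂ := by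
    obtain ⟨X, Y, r, hr⟩ := A.representable
    exact hr.injective (((hr.meet_eq_iff _ _).1 h₁).antisymm ((hr.meet_eq_iff _ _).1 h₂))

theorem IsRepresentation.le_iff {A : DRA.{u}} {X Y : Type u}
    {r : A → Set (X × Y)} (hr : IsRepresentation r) (a b : A) : a ≤ b ↔ r a ⊆ r b :=
  hr.meet_eq_iff a b

/-- Homomorphisms of algebras of the signature of difference and restriction. -/
@[ext]
structure DRA.Hom (A B : DRA.{u}) where
  toFun : A → B
  map_diff : ∀ a b, toFun (a ⊖ b) = toFun a ⊖ toFun b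
  map_rest : ∀ a b, toFun (a ⊳ b) = toFun a ⊳ toFun b

/-- The category of difference-restriction algebras. -/
instance : Category DRA.{u} where
  Hom := DRA.Hom
  id _ := ⟨id, fun _ _ => rfl, fun _ _ => rfl⟩
  comp f g := ⟨g.toFun ∘ f.toFun, by simp [f.map_diff, g.map_diff],
    by simp [f.map_rest, g.map_rest]⟩

/-- Two elements are compatible if `a` restricted to the domain of `b` is `b` restricted to the
domain of `a`. -/
def Compatible {A : DRA.{u}} (a b : A) : Prop := a ⊳ b = b ⊳ a

/-- Every finite set of pairwise compatible elements has a join. -/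
def DRA.FinitarilyCompatiblyComplete : ObjectProperty DRA.{u} := fun A =>
  ∀ S : Set A, S.Finite → (∀ a ∈ S, ∀ b ∈ S, Compatible a b) → ∃ c, IsLUB S c

/-- `S` is finite-join dense in `C`: every element is the join of a finite subset of `S`. -/
def FiniteJoinDense {C : DRA.{u}} (S : Set C) : Prop :=
  ∀ c : C, ∃ T : Set C, T ⊆ S ∧ T.Finite ∧ IsLUB T c

/-- `i` is a finitary compatible completion of `A`. -/
structure DRA.IsFinitaryCompatibleCompletion {A C : DRA.{u}} (i : A ⟶ C) : Prop where
  injective : Function.Injective i.toFun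
  complete : C.FinitarilyCompatiblyComplete
  dense : FiniteJoinDense (Set.range i.toFun)

/-! ### Hausdorff étale spaces -/

/-- A map `π` from a topological space `X` to a topological space `X₀`. -/
structure SpaceMap : Type (u + 1) where
  X : Type u
  X₀ : Type u
  [topX : TopologicalSpace X]
  [topX₀ : TopologicalSpace X₀]
  π : X → X₀

attribute [instance] SpaceMap.topX SpaceMap.topX₀

/-- Hausdorff étale spaces: surjective local homeomorphisms between Hausdorff spaces. -/
structure SpaceMap.IsHausdorffEtale (E : SpaceMap.{u}) : Prop where
  t2 : T2Space E.X
  t2_base : T2Space E.X₀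
  isLocalHomeomorph : IsLocalHomeomorph E.π
  surjective : Function.Surjective E.π

/-- Morphisms of étale spaces: continuous proper partial functions that preserve equivalence and
are fibrewise injective and fibrewise surjective. -/
structure IsEtaleMorphism (E E' : SpaceMap.{u}) (φ : E.X →. E'.X) : Prop where
  continuous : PContinuous φ
  proper : ∀ K : Set E'.X, IsCompact K → IsCompact (φ.preimage K)
  preserves_equiv : ∀ x x' y y', y ∈ φ x → y' ∈ φ x' → E.π x = E.π x' → E'.π y = E'.π y'
  fibrewise_injective : ∀ x x' y, y ∈ φ x → y ∈ φ x' → E.π x = E.π x' → x = x'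
  fibrewise_surjective : ∀ x y y', y ∈ φ x → E'.π y' = E'.π y → ∃ x', E.π x' = E.π x ∧ y' ∈ φ x'

theorem preimage_id {X : Type u} (s : Set X) : (PFun.id X).preimage s = s := by
  rw [← PFun.coe_id, PFun.coe_preimage]; rfl

theorem mem_comp {X Y Z : Type u} {φ : X →. Y} {ψ : Y →. Z} {x : X} {z : Z} :
    z ∈ ψ.comp φ x ↔ ∃ y ∈ φ x, z ∈ ψ y := Part.mem_bind_iff

theorem IsEtaleMorphism.id (E : SpaceMap.{u}) : IsEtaleMorphism E E (PFun.id E.X) where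
  continuous s hs := by rwa [preimage_id]
  proper K hK := by rwa [preimage_id]
  preserves_equiv x x' y y' h h' e := by
    simp only [PFun.id_apply, Part.mem_some_iff] at h h'; rw [h, h', e]
  fibrewise_injective x x' y h h' _ := by
    simp only [PFun.id_apply, Part.mem_some_iff] at h h'; rw [← h, h']
  fibrewise_surjective x y y' h e := by
    simp only [PFun.id_apply, Part.mem_some_iff] at h
    exact ⟨y', by rw [e, h], by simp⟩

theorem IsEtaleMorphism.comp {E E' E'' : SpaceMap.{u}} {φ : E.X →. E'.X} {ψ : E'.X →. E''.X}
    (hψ : IsEtaleMorphism E' E'' ψ) (hφ : IsEtaleMorphism E E' φ) :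
    IsEtaleMorphism E E'' (ψ.comp φ) where
  continuous s hs := by
    rw [PFun.preimage_comp]; exact hφ.continuous _ (hψ.continuous _ hs)
  proper K hK := by
    rw [PFun.preimage_comp]; exact hφ.proper _ (hψ.proper _ hK)
  preserves_equiv x x' y y' h h' e := by
    rw [mem_comp] at h h'
    obtain ⟨z, hz, hy⟩ := h
    obtain ⟨z', hz', hy'⟩ := h'
    exact hψ.preserves_equiv _ _ _ _ hy hy' (hφ.preserves_equiv _ _ _ _ hz hz' e)
  fibrewise_injective x x' y h h' e := by
    rw [mem_comp] at h h'
    obtain ⟨z, hz, hy⟩ := h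
    obtain ⟨z', hz', hy'⟩ := h'
    obtain rfl := hψ.fibrewise_injective _ _ _ hy hy' (hφ.preserves_equiv _ _ _ _ hz hz' e)
    exact hφ.fibrewise_injective _ _ _ hz hz' e
  fibrewise_surjective x y y' h e := by
    rw [mem_comp] at h
    obtain ⟨z, hz, hy⟩ := h
    obtain ⟨z', e', hz'⟩ := hψ.fibrewise_surjective _ _ _ hy e
    obtain ⟨x', e'', hx'⟩ := hφ.fibrewise_surjective _ _ _ hz e'
    exact ⟨x', e'', mem_comp.2 ⟨z', hx', hz'⟩⟩

/-- Hausdorff étale spaces. -/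
structure HausEt : Type (u + 1) where
  toSpaceMap : SpaceMap.{u}
  isHausdorffEtale : toSpaceMap.IsHausdorffEtale

/-- Morphisms of Hausdorff étale spaces. -/
@[ext]
structure HausEt.Hom (E E' : HausEt.{u}) where
  toPFun : E.toSpaceMap.X →. E'.toSpaceMap.X
  isEtaleMorphism : IsEtaleMorphism E.toSpaceMap E'.toSpaceMap toPFun

/-- The category of Hausdorff étale spaces. -/
instance : Category HausEt.{u} where
  Hom := HausEt.Hom
  id _ := ⟨PFun.id _, IsEtaleMorphism.id _⟩
  comp f g := ⟨g.toPFun.comp f.toPFun, g.isEtaleMorphism.comp f.isEtaleMorphism⟩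
  id_comp _ := HausEt.Hom.ext (PFun.comp_id _)
  comp_id _ := HausEt.Hom.ext (PFun.id_comp _)
  assoc _ _ _ := HausEt.Hom.ext (PFun.comp_assoc _ _ _).symm

/-- The total space is locally compact and zero-dimensional (every point has a neighbourhood
basis of compact sets, and one of clopen sets). -/
def HausEt.LocallyCompactZeroDim : ObjectProperty HausEt.{u} := fun E =>
  LocallyCompactSpace E.toSpaceMap.X ∧
    ∀ x : E.toSpaceMap.X, ∀ U ∈ 𝓝 x, ∃ V ∈ 𝓝 x, IsClopen V ∧ V ⊆ U

/-! ### The étale space of maximal filters of an algebra -/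

/-- Maximal filters: proper (nonempty, upward closed, down-directed) filters that are maximal
among proper filters. -/
def MaxFilter (A : DRA.{u}) : Type u :=
  {μ : Set A // Maximal (fun F : Set A => Order.IsPFilter F ∧ F ≠ Set.univ) μ}

instance (A : DRA.{u}) : Membership A (MaxFilter A) := ⟨fun μ a => a ∈ μ.1⟩

/-- The basic open set of all maximal filters that contain `a`. -/
def hat {A : DRA.{u}} (a : A) : Set (MaxFilter A) := {μ | a ∈ μ}

/-- The topology generated by the sets `hat a`. -/
instance (A : DRA.{u}) : TopologicalSpace (MaxFilter A) :=
  TopologicalSpace.generateFrom (Set.range hat)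

theorem isPFilter_iff {A : DRA.{u}} (F : Set A) :
    Order.IsPFilter F ↔
      F.Nonempty ∧ (∀ a ∈ F, ∀ b, a ≤ b → b ∈ F) ∧ ∀ a ∈ F, ∀ b ∈ F, meet a b ∈ F := by
  obtain ⟨X, Y, r, hr⟩ := A.representable
  constructor
  · intro h
    have up : ∀ a ∈ F, ∀ b, a ≤ b → b ∈ F := fun a ha b hab =>
      (h.toPFilter).mem_of_le hab ha
    refine ⟨h.toPFilter.nonempty, up, fun a ha b hb => ?_⟩
    obtain ⟨c, hc, hca, hcb⟩ := h.toPFilter.directed a ha b hb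
    refine up c hc _ ((hr.le_iff _ _).2 ?_)
    rw [hr.map_meet]
    exact Set.subset_inter ((hr.le_iff c a).1 hca) ((hr.le_iff c b).1 hcb)
  · rintro ⟨hne, hup, hm⟩
    refine Order.IsPFilter.of_def hne (fun a ha b hb => ⟨meet a b, hm a ha b hb, ?_, ?_⟩)
      (fun {a b} hab ha => hup a ha b hab)
    · exact (hr.le_iff _ _).2 (by rw [hr.map_meet]; exact Set.inter_subset_left)
    · exact (hr.le_iff _ _).2 (by rw [hr.map_meet]; exact Set.inter_subset_right)

theorem MaxFilter.up {A : DRA.{u}} (μ : MaxFilter A) {a b : A} (ha : a ∈ μ) (h : a ≤ b) :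
    b ∈ μ := ((isPFilter_iff _).1 μ.2.1.1).2.1 a ha b h

theorem MaxFilter.meet_mem {A : DRA.{u}} (μ : MaxFilter A) {a b : A} (ha : a ∈ μ) (hb : b ∈ μ) :
    meet a b ∈ μ := ((isPFilter_iff _).1 μ.2.1.1).2.2 a ha b hb

theorem MaxFilter.exists_mem {A : DRA.{u}} (μ : MaxFilter A) : ∃ a, a ∈ μ :=
  ((isPFilter_iff _).1 μ.2.1.1).1

/-- A proper filter does not contain the zero element. -/
theorem MaxFilter.diff_self_notMem {A : DRA.{u}} (μ : MaxFilter A) (a : A) : a ⊖ a ∉ μ := by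
  intro h
  obtain ⟨X, Y, r, hr⟩ := A.representable
  refine μ.2.1.2 (Set.eq_univ_of_forall fun b => μ.up h ((hr.le_iff _ _).2 ?_))
  simp [hr.map_diff]

/-- Of two complementary parts of a member of a maximal filter, one is a member. -/
theorem MaxFilter.diff_mem {A : DRA.{u}} (μ : MaxFilter A) {a b : A} (ha : a ∈ μ)
    (hb : meet a b ∉ μ) : a ⊖ b ∈ μ := by
  obtain ⟨X, Y, r, hr⟩ := A.representable
  by_contra hd
  let G : Set A := {x | ∃ f ∈ μ, meet f b ≤ x}
  have hG : Order.IsPFilter G := by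
    refine (isPFilter_iff _).2 ⟨⟨_, a, ha, le_rfl⟩, ?_, ?_⟩
    · rintro x ⟨f, hf, hx⟩ y hxy
      exact ⟨f, hf, hx.trans hxy⟩
    · rintro x ⟨f, hf, hx⟩ y ⟨g, hg, hy⟩
      refine ⟨meet f g, μ.meet_mem hf hg, ?_⟩
      rw [hr.le_iff] at hx hy ⊢
      simp only [hr.map_meet] at hx hy ⊢
      intro p hp
      exact ⟨hx ⟨hp.1.1, hp.2⟩, hy ⟨hp.1.2, hp.2⟩⟩
  have hle : μ.1 ⊆ G := fun f hf =>
    ⟨f, hf, (hr.le_iff _ _).2 (by rw [hr.map_meet]; exact Set.inter_subset_left)⟩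
  have hbG : meet a b ∈ G := ⟨a, ha, le_rfl⟩
  by_cases hu : G = Set.univ
  · obtain ⟨f, hf, hx⟩ : a ⊖ a ∈ G := hu ▸ Set.mem_univ _
    refine hd (μ.up (μ.meet_mem ha hf) ?_)
    rw [hr.le_iff] at hx ⊢
    simp only [hr.map_meet, hr.map_diff] at hx ⊢
    intro p hp
    refine ⟨hp.1, fun hpb => ?_⟩
    have := hx ⟨hp.2, hpb⟩
    exact this.2 this.1
  · exact hb (μ.2.2 ⟨hG, hu⟩ hle hbG)

/-- Two maximal filters are equivalent if each restricts into the other. -/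
instance filterSetoid (A : DRA.{u}) : Setoid (MaxFilter A) where
  r μ ν := ∀ a ∈ μ, ∀ b ∈ ν, a ⊳ b ∈ ν ∧ b ⊳ a ∈ μ
  iseqv := by
    obtain ⟨X, Y, r, hr⟩ := A.representable
    refine ⟨?_, fun h a ha b hb => (h b hb a ha).symm, ?_⟩
    · have key : ∀ (μ : MaxFilter A), ∀ a ∈ μ, ∀ b ∈ μ, a ⊳ b ∈ μ := by
        intro μ a ha b hb
        refine μ.up (μ.meet_mem ha hb) ((hr.le_iff _ _).2 ?_)
        rw [hr.map_meet, hr.map_rest]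
        exact fun p hp => ⟨⟨p.2, hp.1⟩, hp.2⟩
      exact fun μ a ha b hb => ⟨key μ a ha b hb, key μ b hb a ha⟩
    · intro μ ν ξ h₁ h₂ a ha c hc
      obtain ⟨b, hb⟩ := ν.exists_mem
      have le : ∀ a b c : A, (a ⊳ b) ⊳ c ≤ a ⊳ c := by
        intro a b c
        rw [hr.le_iff]
        simp only [hr.map_rest]
        rintro p ⟨⟨y, hy⟩, hp⟩
        exact ⟨hy.1, hp⟩
      exact ⟨ξ.up (h₂ _ (h₁ a ha b hb).1 c hc).1 (le a b c),
        μ.up (h₁ a ha _ (h₂ b hb c hc).2).2 (le c b a)⟩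

/-- The canonical quotient map from the space of maximal filters onto its quotient (with the
quotient topology) by the above equivalence. -/
def filterSpace (A : DRA.{u}) : SpaceMap.{u} where
  X := MaxFilter A
  X₀ := Quotient (filterSetoid A)
  π := Quotient.mk _

theorem DRA.Hom.map_meet {A B : DRA.{u}} (h : A.Hom B) (a b : A) :
    h.toFun (meet a b) = meet (h.toFun a) (h.toFun b) := by
  simp [meet, h.map_diff]

theorem DRA.Hom.monotone {A B : DRA.{u}} (h : A.Hom B) {a b : A} (hab : a ≤ b) :
    h.toFun a ≤ h.toFun b := by
  change meet _ _ = _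
  rw [← h.map_meet]
  exact congrArg h.toFun hab

/-- A filter without the zero element that contains one of any two complementary parts of its
members is maximal. -/
theorem maximal_of_prime {A : DRA.{u}} {F : Set A} (hF : Order.IsPFilter F)
    (h0 : ∀ a, a ⊖ a ∉ F) (hp : ∀ a ∈ F, ∀ b, meet a b ∈ F ∨ a ⊖ b ∈ F) :
    Maximal (fun F : Set A => Order.IsPFilter F ∧ F ≠ Set.univ) F := by
  obtain ⟨X, Y, r, hr⟩ := A.representable
  have hF' := (isPFilter_iff _).1 hF
  obtain ⟨a, ha⟩ := hF'.1
  refine ⟨⟨hF, fun hu => h0 a (hu ▸ Set.mem_univ _)⟩, ?_⟩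
  rintro G ⟨hG, hGu⟩ hle b hb
  rw [isPFilter_iff] at hG
  rcases hp a ha b with h | h
  · exact hF'.2.1 _ h _
      ((hr.le_iff _ _).2 (by rw [hr.map_meet]; exact Set.inter_subset_right))
  · refine absurd (Set.eq_univ_of_forall fun c => hG.2.1 _ (hG.2.2 _ (hle h) _ hb) _
      ((hr.le_iff _ _).2 ?_)) hGu
    rw [hr.map_meet, hr.map_diff]
    rintro p ⟨hp, hp'⟩
    exact absurd hp' hp.2

/-- A nonempty preimage of a maximal filter under a homomorphism is a maximal filter. -/
theorem maximal_preimage {A B : DRA.{u}} (h : A ⟶ B) (ξ : MaxFilter B)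
    (hne : ∃ a, h.toFun a ∈ ξ) :
    Maximal (fun F : Set A => Order.IsPFilter F ∧ F ≠ Set.univ) {a | h.toFun a ∈ ξ} := by
  refine maximal_of_prime ((isPFilter_iff _).2 ⟨hne, fun a ha b hab => ξ.up ha (h.monotone hab),
    fun a ha b hb => ?_⟩) (fun a ha => ?_) (fun a ha b => ?_)
  · change h.toFun _ ∈ ξ
    rw [h.map_meet]
    exact ξ.meet_mem ha hb
  · change h.toFun _ ∈ ξ at ha
    rw [h.map_diff] at ha
    exact ξ.diff_self_notMem _ ha
  · change h.toFun _ ∈ ξ ∨ h.toFun _ ∈ ξ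
    rw [h.map_meet, h.map_diff]
    by_cases hm : meet (h.toFun a) (h.toFun b) ∈ ξ
    · exact Or.inl hm
    · exact Or.inr (ξ.diff_mem ha hm)

/-- The partial map between spaces of maximal filters induced by a homomorphism: preimage, defined
where the preimage is nonempty. -/
def filterMap {A B : DRA.{u}} (h : A ⟶ B) : MaxFilter B →. MaxFilter A := fun ξ =>
  ⟨∃ a, h.toFun a ∈ ξ, fun hne => ⟨{a | h.toFun a ∈ ξ}, maximal_preimage h ξ hne⟩⟩

theorem filterMap_id (A : DRA.{u}) : filterMap (𝟙 A) = PFun.id (MaxFilter A) := by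
  funext ξ
  refine Part.ext' ⟨fun _ => trivial, fun _ => ξ.exists_mem⟩ fun _ _ => rfl

theorem filterMap_comp {A B C : DRA.{u}} (h : A ⟶ B) (k : B ⟶ C) :
    filterMap (h ≫ k) = (filterMap h).comp (filterMap k) := by
  funext ξ
  refine Part.ext' ⟨fun ⟨a, ha⟩ => ⟨⟨h.toFun a, ha⟩, a, ha⟩, fun ⟨_, a, ha⟩ => ⟨a, ha⟩⟩
    fun _ _ => rfl

theorem mem_filterMap {A B : DRA.{u}} {h : A ⟶ B} {ξ : MaxFilter B} {μ : MaxFilter A} :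
    μ ∈ filterMap h ξ ↔ ∀ a, a ∈ μ ↔ h.toFun a ∈ ξ := by
  constructor
  · rintro ⟨_, rfl⟩ a
    exact Iff.rfl
  · intro e
    obtain ⟨a, ha⟩ := μ.exists_mem
    exact ⟨⟨a, (e a).1 ha⟩, Subtype.ext (Set.ext fun b => (e b).symm)⟩

theorem MaxFilter.ext_of_le {A : DRA.{u}} {μ ν : MaxFilter A} (h : ∀ a ∈ μ, a ∈ ν) : μ = ν :=
  Subtype.ext (Set.Subset.antisymm h (μ.2.2 ν.2.1 h))

theorem MaxFilter.mem_meet_iff {A : DRA.{u}} (μ : MaxFilter A) (a b : A) :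
    meet a b ∈ μ ↔ a ∈ μ ∧ b ∈ μ := by
  obtain ⟨X, Y, r, hr⟩ := A.representable
  refine ⟨fun h => ⟨μ.up h ?_, μ.up h ?_⟩, fun h => μ.meet_mem h.1 h.2⟩
  · exact (hr.le_iff _ _).2 (by rw [hr.map_meet]; exact Set.inter_subset_left)
  · exact (hr.le_iff _ _).2 (by rw [hr.map_meet]; exact Set.inter_subset_right)

theorem MaxFilter.notMem_of_rep_empty {A : DRA.{u}} (μ : MaxFilter A) {X Y : Type u}
    {r : A → Set (X × Y)} (hr : IsRepresentation r) {a : A} (h : r a = ∅) : a ∉ μ := fun ha =>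
  μ.diff_self_notMem a (μ.up ha ((hr.le_iff _ _).2 (by rw [h]; exact Set.empty_subset _)))

theorem isTopologicalBasis_hat (A : DRA.{u}) :
    TopologicalSpace.IsTopologicalBasis (Set.range (hat : A → Set (MaxFilter A))) where
  exists_subset_inter := by
    rintro _ ⟨a, rfl⟩ _ ⟨b, rfl⟩ μ hμ
    exact ⟨hat (meet a b), ⟨_, rfl⟩, (μ.mem_meet_iff a b).2 hμ,
      fun ν hν => (ν.mem_meet_iff a b).1 hν⟩
  sUnion_eq := Set.eq_univ_of_forall fun μ =>
    let ⟨a, ha⟩ := μ.exists_mem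
    ⟨hat a, ⟨a, rfl⟩, ha⟩
  eq_generateFrom := rfl

theorem isOpen_hat {A : DRA.{u}} (a : A) : IsOpen (hat a) :=
  (isTopologicalBasis_hat A).isOpen ⟨a, rfl⟩

theorem exists_hat_subset {A : DRA.{u}} {s : Set (MaxFilter A)} (hs : IsOpen s) {μ : MaxFilter A}
    (hμ : μ ∈ s) : ∃ a ∈ μ, hat a ⊆ s := by
  obtain ⟨_, ⟨a, rfl⟩, ha, has⟩ := (isTopologicalBasis_hat A).exists_subset_of_mem_open hμ hs
  exact ⟨a, ha, has⟩

theorem isCompact_hat {A : DRA.{u}} (a : A) : IsCompact (hat a) := by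
  obtain ⟨X, Y, r, hr⟩ := A.representable
  rw [isCompact_iff_ultrafilter_le_nhds]
  intro U hU
  have haU : hat a ∈ U := Filter.le_principal_iff.1 hU
  have hmax := maximal_of_prime (A := A) (F := {b | hat b ∈ U})
    ((isPFilter_iff _).2 ⟨⟨a, haU⟩, fun b hb c hbc =>
      Filter.mem_of_superset hb fun μ hμ => μ.up hμ hbc, fun b hb c hc =>
      Filter.mem_of_superset (Filter.inter_mem hb hc) fun μ hμ => μ.meet_mem hμ.1 hμ.2⟩)
    (fun b hb => by
      obtain ⟨μ, hμ⟩ := U.nonempty_of_mem hb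
      exact μ.diff_self_notMem b hμ)
    (fun b hb c => by
      refine Ultrafilter.union_mem_iff.1 (Filter.mem_of_superset hb fun μ hμ => ?_)
      by_cases h : meet b c ∈ μ
      · exact Or.inl h
      · exact Or.inr (μ.diff_mem hμ h))
  refine ⟨⟨_, hmax⟩, haU, (isTopologicalBasis_hat A).nhds_hasBasis.ge_iff.2 ?_⟩
  rintro _ ⟨⟨b, rfl⟩, hb⟩
  exact hb

theorem t2Space_maxFilter (A : DRA.{u}) : T2Space (MaxFilter A) where
  t2 μ ν hne := by
    obtain ⟨X, Y, r, hr⟩ := A.representable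
    obtain ⟨a, haμ, haν⟩ : ∃ a ∈ μ, a ∉ ν := by
      by_contra! h
      exact hne (MaxFilter.ext_of_le h)
    obtain ⟨b, hb⟩ := ν.exists_mem
    refine ⟨hat a, hat (b ⊖ a), isOpen_hat a, isOpen_hat _, haμ,
      ν.diff_mem hb fun h => haν ((ν.mem_meet_iff b a).1 h).2, ?_⟩
    refine Set.disjoint_left.2 fun ξ h1 h2 =>
      ξ.notMem_of_rep_empty hr ?_ (ξ.meet_mem h1 h2)
    rw [hr.map_meet, hr.map_diff]
    exact Set.inter_sdiff_self _ _

/-- Equivalent maximal filters with a common element are equal. -/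
theorem eq_of_equiv {A : DRA.{u}} {μ ν : MaxFilter A} (h : μ ≈ ν) {a : A} (hμ : a ∈ μ)
    (hν : a ∈ ν) : μ = ν := by
  obtain ⟨X, Y, r, hr⟩ := A.representable
  refine MaxFilter.ext_of_le fun c hc => ?_
  refine ν.up (h _ (μ.meet_mem hc hμ) a hν).1 ((hr.le_iff _ _).2 ?_)
  rw [hr.map_rest, hr.map_meet]
  rintro ⟨x, y⟩ ⟨⟨z, hz⟩, hy⟩
  obtain rfl := hr.isPartialFunction a _ _ _ hz.2 hy
  exact hz.1

/-- Inequivalent maximal filters contain elements with disjoint domains. -/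
theorem exists_of_not_equiv {A : DRA.{u}} {μ ν : MaxFilter A} (h : ¬ μ ≈ ν) :
    ∃ a ∈ μ, ∃ b ∈ ν, a ⊳ b = a ⊖ a ∧ b ⊳ a = a ⊖ a := by
  obtain ⟨X, Y, r, hr⟩ := A.representable
  have key : ∀ μ ν : MaxFilter A, ∀ a ∈ μ, ∀ b ∈ ν, a ⊳ b ∉ ν →
      ∃ a ∈ μ, ∃ b ∈ ν, r (a ⊳ b) = ∅ ∧ r (b ⊳ a) = ∅ := by
    intro μ ν a ha b hb hab
    refine ⟨a, ha, b ⊖ (a ⊳ b), ν.diff_mem hb fun h => hab ((ν.mem_meet_iff _ _).1 h).2, ?_, ?_⟩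
    · simp only [hr.map_rest, hr.map_diff]
      refine Set.eq_empty_of_forall_notMem ?_
      rintro p ⟨h1, h2, h3⟩
      exact h3 ⟨h1, h2⟩
    · simp only [hr.map_rest, hr.map_diff]
      refine Set.eq_empty_of_forall_notMem ?_
      rintro ⟨x, y⟩ ⟨⟨z, h1, h2⟩, h3⟩
      exact h2 ⟨⟨y, h3⟩, h1⟩
  have fin : ∀ a b c : A, r (a ⊳ b) = ∅ → a ⊳ b = c ⊖ c := fun a b c h =>
    hr.injective (by rw [h, hr.map_diff, Set.sdiff_self])
  obtain ⟨a, ha, b, hb, hab⟩ : ∃ a ∈ μ, ∃ b ∈ ν, ¬ (a ⊳ b ∈ ν ∧ b ⊳ a ∈ μ) := by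
    by_contra! h'
    exact h fun a ha b hb => h' a ha b hb
  by_cases h1 : a ⊳ b ∈ ν
  · obtain ⟨b', hb', a', ha', e, e'⟩ := key ν μ b hb a ha fun h2 => hab ⟨h1, h2⟩
    exact ⟨a', ha', b', hb', fin _ _ _ e', fin _ _ _ e⟩
  · obtain ⟨a', ha', b', hb', e, e'⟩ := key μ ν a ha b hb h1
    exact ⟨a', ha', b', hb', fin _ _ _ e, fin _ _ _ e'⟩

/-- If a maximal filter contains a restriction to the domain of `a`, then some equivalent maximal
filter contains `a`. -/
theorem exists_equiv_mem {A : DRA.{u}} {ν : MaxFilter A} {a b : A} (hab : a ⊳ b ∈ ν) :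
    ∃ μ : MaxFilter A, a ∈ μ ∧ μ ≈ ν := by
  obtain ⟨X, Y, r, hr⟩ := A.representable
  have hmax := maximal_of_prime (A := A) (F := {c | ∃ d ∈ ν, d ⊳ a ≤ c}) ?_ ?_ ?_
  · refine ⟨⟨_, hmax⟩, ⟨_, hab, ?_⟩, ?_⟩
    · rw [hr.le_iff, hr.map_rest]
      exact fun p hp => hp.2
    · rintro c ⟨d, hd, hdc⟩ e he
      rw [hr.le_iff, hr.map_rest] at hdc
      constructor
      · refine ν.up (ν.meet_mem (ν.meet_mem hd hab) he) ((hr.le_iff _ _).2 ?_)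
        simp only [hr.map_meet, hr.map_rest]
        rintro ⟨x, y⟩ ⟨⟨h1, ⟨z, h2⟩, h3⟩, h4⟩
        exact ⟨⟨z, hdc ⟨⟨y, h1⟩, h2⟩⟩, h4⟩
      · refine ⟨meet d e, ν.meet_mem hd he, (hr.le_iff _ _).2 ?_⟩
        simp only [hr.map_meet, hr.map_rest]
        rintro ⟨x, y⟩ ⟨⟨z, h1, h2⟩, h3⟩
        exact ⟨⟨z, h2⟩, hdc ⟨⟨z, h1⟩, h3⟩⟩
  · refine (isPFilter_iff _).2 ⟨⟨_, _, hab, le_rfl⟩, ?_, ?_⟩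
    · rintro c ⟨d, hd, hdc⟩ c' hc
      exact ⟨d, hd, hdc.trans hc⟩
    · rintro c ⟨d, hd, hdc⟩ c' ⟨d', hd', hdc'⟩
      refine ⟨meet d d', ν.meet_mem hd hd', ?_⟩
      rw [hr.le_iff] at *
      simp only [hr.map_meet, hr.map_rest] at *
      rintro ⟨x, y⟩ ⟨⟨z, h1, h2⟩, h3⟩
      exact ⟨hdc ⟨⟨z, h1⟩, h3⟩, hdc' ⟨⟨z, h2⟩, h3⟩⟩
  · rintro c ⟨d, hd, hdc⟩
    refine ν.notMem_of_rep_empty hr ?_ (ν.meet_mem hd hab)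
    rw [hr.le_iff] at hdc
    simp only [hr.map_meet, hr.map_rest, hr.map_diff, Set.sdiff_self] at *
    refine Set.eq_empty_of_forall_notMem ?_
    rintro ⟨x, y⟩ ⟨h1, ⟨z, h2⟩, h3⟩
    exact hdc ⟨⟨y, h1⟩, h2⟩
  · rintro c ⟨d, hd, hdc⟩ e
    let f := meet (d ⊳ a) e
    have hd' : meet d (a ⊳ b) ∈ ν := ν.meet_mem hd hab
    rw [hr.le_iff, hr.map_rest] at hdc
    by_cases hf : meet (meet d (a ⊳ b)) (f ⊳ meet d (a ⊳ b)) ∈ ν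
    · left
      refine ⟨_, hf, (hr.le_iff _ _).2 ?_⟩
      simp only [f, hr.map_meet, hr.map_rest]
      rintro ⟨x, y⟩ ⟨⟨z, -, ⟨w, ⟨⟨v, h1⟩, h2⟩, h3⟩, -⟩, h4⟩
      obtain rfl := hr.isPartialFunction a _ _ _ h2 h4
      exact ⟨hdc ⟨⟨v, h1⟩, h2⟩, h3⟩
    · right
      refine ⟨_, ν.diff_mem hd' hf, (hr.le_iff _ _).2 ?_⟩
      simp only [f, hr.map_meet, hr.map_rest, hr.map_diff]
      rintro ⟨x, y⟩ ⟨⟨z, h1, h2⟩, h3⟩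
      exact ⟨hdc ⟨⟨z, h1.1⟩, h3⟩, fun h4 => h2 ⟨⟨y, ⟨⟨z, h1.1⟩, h3⟩, h4⟩, h1⟩⟩

theorem isOpenMap_filterSpace (A : DRA.{u}) : IsOpenMap (Quotient.mk (filterSetoid A)) := by
  intro s hs
  rw [isOpen_coinduced, isOpen_iff_forall_mem_open]
  rintro ν ⟨μ, hμs, hμν⟩
  have hμν : μ ≈ ν := Quotient.exact hμν
  obtain ⟨a, ha, has⟩ := exists_hat_subset hs hμs
  obtain ⟨b, hb⟩ := ν.exists_mem
  refine ⟨hat (a ⊳ b), fun ξ hξ => ?_, isOpen_hat _, (hμν a ha b hb).1⟩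
  obtain ⟨ζ, hζ, e⟩ := exists_equiv_mem hξ
  exact ⟨ζ, has hζ, Quotient.sound e⟩

/-- The canonical map from the space of maximal filters onto its quotient is a Hausdorff étale
space. -/
theorem filterSpace_isHausdorffEtale (A : DRA.{u}) : (filterSpace A).IsHausdorffEtale where
  t2 := t2Space_maxFilter A
  t2_base := by
    refine ⟨fun p q => Quotient.inductionOn₂ p q fun μ ν hne => ?_⟩
    obtain ⟨a, ha, b, hb, e, -⟩ := exists_of_not_equiv fun h : μ ≈ ν => hne (Quotient.sound h)
    refine ⟨Quotient.mk _ '' hat a, Quotient.mk _ '' hat b, isOpenMap_filterSpace A _ (isOpen_hat a),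
      isOpenMap_filterSpace A _ (isOpen_hat b), ⟨μ, ha, rfl⟩, ⟨ν, hb, rfl⟩, ?_⟩
    refine Set.disjoint_left.2 ?_
    rintro _ ⟨ξ, hξ, rfl⟩ ⟨ζ, hζ, h⟩
    have h : ξ ≈ ζ := Setoid.symm (Quotient.exact h)
    have := (h a hξ b hζ).1
    rw [e] at this
    exact ζ.diff_self_notMem a this
  isLocalHomeomorph := by
    rw [isLocalHomeomorph_iff_isOpenEmbedding_restrict]
    intro μ
    obtain ⟨a, ha⟩ := MaxFilter.exists_mem μ
    refine ⟨hat a, (isOpen_hat a).mem_nhds ha, .of_continuous_injective_isOpenMap ?_ ?_ ?_⟩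
    · exact continuous_quotient_mk'.comp continuous_subtype_val
    · rintro ⟨ν, hν⟩ ⟨ξ, hξ⟩ h
      exact Subtype.ext (eq_of_equiv (Quotient.exact h) hν hξ)
    · exact (isOpenMap_filterSpace A).comp (isOpen_hat a).isOpenMap_subtype_val
  surjective := Quotient.mk_surjective

theorem filterMap_equiv {A B : DRA.{u}} {h : A ⟶ B} {ξ ξ' : MaxFilter B} {μ μ' : MaxFilter A}
    (hμ : μ ∈ filterMap h ξ) (hμ' : μ' ∈ filterMap h ξ') (e : ξ ≈ ξ') : μ ≈ μ' := by
  rw [mem_filterMap] at hμ hμ'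
  intro a ha b hb
  have := e _ ((hμ a).1 ha) _ ((hμ' b).1 hb)
  rw [← h.map_rest, ← h.map_rest] at this
  exact ⟨(hμ' _).2 this.1, (hμ _).2 this.2⟩

theorem preimage_filterMap_hat {A B : DRA.{u}} (h : A ⟶ B) (a : A) :
    (filterMap h).preimage (hat a) = hat (h.toFun a) := by
  ext ξ
  constructor
  · rintro ⟨μ, ha, hμ⟩
    exact (mem_filterMap.1 hμ a).1 ha
  · intro ha
    exact ⟨⟨_, maximal_preimage h ξ ⟨a, ha⟩⟩, ha, ⟨a, ha⟩, rfl⟩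

/-- The partial map induced by a homomorphism is a morphism of étale spaces. -/
theorem filterMap_isEtaleMorphism {A B : DRA.{u}} (h : A ⟶ B) :
    IsEtaleMorphism (filterSpace B) (filterSpace A) (filterMap h) := by
  have hcont : PContinuous (filterMap h) := by
    intro s hs
    rw [isOpen_iff_forall_mem_open]
    rintro ξ ⟨μ, hμs, hμ⟩
    obtain ⟨a, ha, has⟩ := exists_hat_subset hs hμs
    refine ⟨hat (h.toFun a), ?_, isOpen_hat _, (mem_filterMap.1 hμ a).1 ha⟩
    rw [← preimage_filterMap_hat]
    exact PFun.preimage_mono _ has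
  refine ⟨hcont, ?_, ?_, ?_, ?_⟩
  · intro (K : Set (MaxFilter A)) (hK : IsCompact (X := MaxFilter A) K)
    have := t2Space_maxFilter A
    obtain ⟨t, ht⟩ := hK.elim_finite_subcover (fun a : A => hat a) isOpen_hat fun μ _ => by
      obtain ⟨a, ha⟩ := MaxFilter.exists_mem μ
      exact Set.mem_iUnion.2 ⟨a, ha⟩
    have hC : IsCompact (⋃ a ∈ t, hat (h.toFun a)) :=
      t.isCompact_biUnion fun a _ => isCompact_hat _
    have heq : (filterMap h).preimage K =
        (⋃ a ∈ t, hat (h.toFun a)) \ (filterMap h).preimage Kᶜ := ?_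
    · exact heq ▸ hC.diff (hcont Kᶜ hK.isClosed.isOpen_compl)
    ext ξ
    constructor
    · rintro ⟨μ, hμK, hμ⟩
      refine ⟨?_, fun ⟨ν, hνK, hν⟩ => hνK (Part.mem_unique hμ hν ▸ hμK)⟩
      obtain ⟨a, hat, haμ⟩ := Set.mem_iUnion₂.1 (ht hμK)
      exact Set.mem_iUnion₂.2 ⟨a, hat, (mem_filterMap.1 hμ a).1 haμ⟩
    · rintro ⟨h1, h2⟩
      obtain ⟨a, -, ha⟩ := Set.mem_iUnion₂.1 h1
      obtain ⟨μ, -, hμ⟩ : ξ ∈ (filterMap h).preimage (hat a) := by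
        rw [preimage_filterMap_hat]; exact ha
      by_contra h3
      exact h2 ⟨μ, fun hμK => h3 ⟨μ, hμK, hμ⟩, hμ⟩
  · intro ξ ξ' μ μ' hμ hμ' e
    exact Quotient.sound (filterMap_equiv hμ hμ' (Quotient.exact e))
  · intro ξ ξ' μ hμ hμ' e
    obtain ⟨a, ha⟩ := MaxFilter.exists_mem μ
    exact eq_of_equiv (Quotient.exact e) ((mem_filterMap.1 hμ a).1 ha)
      ((mem_filterMap.1 hμ' a).1 ha)
  · intro (ξ : MaxFilter B) (μ : MaxFilter A) (μ' : MaxFilter A) hμ e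
    have e : μ' ≈ μ := Quotient.exact e
    obtain ⟨b, hb⟩ := MaxFilter.exists_mem μ
    obtain ⟨c, hc⟩ := MaxFilter.exists_mem μ'
    have h1 := (mem_filterMap.1 hμ _).1 (e c hc b hb).1
    rw [h.map_rest] at h1
    obtain ⟨ζ, hζ, hζξ⟩ := exists_equiv_mem h1
    have hν : (⟨_, maximal_preimage h ζ ⟨c, hζ⟩⟩ : MaxFilter A) ∈ filterMap h ζ :=
      ⟨⟨c, hζ⟩, rfl⟩
    refine ⟨ζ, Quotient.sound hζξ, ?_⟩
    rwa [eq_of_equiv (Setoid.trans e (Setoid.symm (filterMap_equiv hν hμ hζξ))) hc hζ]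

/-- The functor from difference-restriction algebras to Hausdorff étale spaces. -/
def functorF : DRA.{u} ⥤ HausEt.{u}ᵒᵖ where
  obj A := op ⟨filterSpace A, filterSpace_isHausdorffEtale A⟩
  map h := Quiver.Hom.op (HausEt.Hom.mk (filterMap h) (filterMap_isEtaleMorphism h))
  map_id A := congrArg Quiver.Hom.op (HausEt.Hom.ext (filterMap_id A))
  map_comp h k := congrArg Quiver.Hom.op (HausEt.Hom.ext (filterMap_comp h k))

/-! ### The algebra of compact open sets on which the étale map is injective -/

/-- Compact open sets on which the étale map is injective. -/
def Ko (E : SpaceMap.{u}) : Type u :=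
  {U : Set E.X // IsCompact U ∧ IsOpen U ∧ Set.InjOn E.π U}

/-- Difference and restriction of compact open sets on which the étale map is injective. -/
instance koStr (E : HausEt.{u}) : DiffRest (Ko E.toSpaceMap) where
  diff U V := ⟨U.1 \ V.1, by
    have := E.isHausdorffEtale.t2
    exact ⟨U.2.1.diff V.2.2.1, U.2.2.1.sdiff V.2.1.isClosed, U.2.2.2.mono Set.sdiff_subset⟩⟩
  rest U V := ⟨E.toSpaceMap.π ⁻¹' (E.toSpaceMap.π '' U.1) ∩ V.1, by
    have := E.isHausdorffEtale.t2_base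
    have hc := E.isHausdorffEtale.isLocalHomeomorph.continuous
    have ho := E.isHausdorffEtale.isLocalHomeomorph.isOpenMap
    exact ⟨V.2.1.inter_left ((U.2.1.image hc).isClosed.preimage hc),
      ((ho _ U.2.2.1).preimage hc).inter V.2.2.1, V.2.2.2.mono Set.inter_subset_right⟩⟩

theorem ko_isRepresentation (E : HausEt.{u}) :
    IsRepresentation (fun U : Ko E.toSpaceMap =>
      {p : E.toSpaceMap.X₀ × E.toSpaceMap.X | p.2 ∈ U.1 ∧ E.toSpaceMap.π p.2 = p.1}) where
  injective U V h := by
    refine Subtype.ext (Set.ext fun x => ?_)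
    have := Set.ext_iff.1 h (E.toSpaceMap.π x, x)
    simpa using this
  isPartialFunction U x y z hy hz := U.2.2.2 hy.1 hz.1 (hy.2.trans hz.2.symm)
  map_diff U V := by
    ext ⟨x₀, x⟩
    simp only [DiffRest.diff, Set.mem_ofPred_eq, Set.mem_sdiff]
    tauto
  map_rest U V := by
    ext ⟨x₀, x⟩
    simp only [DiffRest.rest, domRestrict, Set.mem_ofPred_eq, Set.mem_inter_iff, Set.mem_preimage,
      Set.mem_image]
    constructor
    · rintro ⟨⟨⟨y, hy, e⟩, hx⟩, rfl⟩
      exact ⟨⟨y, hy, e⟩, hx, rfl⟩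
    · rintro ⟨⟨y, hy, e⟩, hx, rfl⟩
      exact ⟨⟨⟨y, hy, e⟩, hx⟩, rfl⟩

/-- The difference-restriction algebra of a Hausdorff étale space. -/
def koAlg (E : HausEt.{u}) : DRA.{u} where
  carrier := Ko E.toSpaceMap
  nonempty := ⟨⟨∅, by simp⟩⟩
  representable := ⟨_, _, _, ko_isRepresentation E⟩

/-- The homomorphism induced by a morphism of Hausdorff étale spaces: preimage. -/
def koMap {E E' : HausEt.{u}} (φ : E ⟶ E') : koAlg E' ⟶ koAlg E where
  toFun U := ⟨φ.toPFun.preimage U.1, φ.isEtaleMorphism.proper _ U.2.1,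
    φ.isEtaleMorphism.continuous _ U.2.2.1, by
      rintro x ⟨y, hy, hxy⟩ x' ⟨y', hy', hxy'⟩ e
      obtain rfl := U.2.2.2 hy hy' (φ.isEtaleMorphism.preserves_equiv _ _ _ _ hxy hxy' e)
      exact φ.isEtaleMorphism.fibrewise_injective _ _ _ hxy hxy' e⟩
  map_diff U V := by
    refine Subtype.ext (Set.ext fun x => ?_)
    constructor
    · rintro ⟨y, ⟨hU, hV⟩, hy⟩
      exact ⟨⟨y, hU, hy⟩, fun ⟨z, hz, hxz⟩ => hV (Part.mem_unique hxz hy ▸ hz)⟩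
    · rintro ⟨⟨y, hU, hy⟩, hV⟩
      exact ⟨y, ⟨hU, fun h => hV ⟨y, h, hy⟩⟩, hy⟩
  map_rest U V := by
    refine Subtype.ext (Set.ext fun x => ?_)
    constructor
    · rintro ⟨y, ⟨⟨z, hz, e⟩, hV⟩, hy⟩
      obtain ⟨x', e', hx'⟩ := φ.isEtaleMorphism.fibrewise_surjective _ _ _ hy e
      exact ⟨⟨x', ⟨z, hz, hx'⟩, e'⟩, y, hV, hy⟩
    · rintro ⟨⟨x', ⟨z, hz, hx'⟩, e⟩, y, hV, hy⟩
      exact ⟨y, ⟨⟨z, hz, φ.isEtaleMorphism.preserves_equiv _ _ _ _ hx' hy e⟩, hV⟩, hy⟩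

/-- The functor from Hausdorff étale spaces to difference-restriction algebras. -/
def functorG : HausEt.{u}ᵒᵖ ⥤ DRA.{u} where
  obj E := koAlg E.unop
  map φ := koMap φ.unop
  map_id _ := DRA.Hom.ext (funext fun U => Subtype.ext (preimage_id U.1))
  map_comp _ _ := DRA.Hom.ext (funext fun U => Subtype.ext (PFun.preimage_comp _ _ U.1))

/-! ### Operators -/

/-- A functional signature: a type of operation symbols with (possibly zero) arities. -/
structure Signature : Type (w + 1) where
  Symbol : Type w
  arity : Symbol → ℕ

/-- Compatibility preserving operators on a difference-restriction algebra. -/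
structure IsCompatibilityPreservingOperator {A : DRA.{u}} {n : ℕ} (Ω : (Fin n → A) → A) :
    Prop where
  compatibility_preserving : ∀ a a' : Fin n → A,
    (∀ i, Compatible (a i) (a' i)) → Compatible (Ω a) (Ω a')
  normal : ∀ (i : Fin n) (a : Fin n → A), IsBot (a i) → IsBot (Ω a)
  additive : ∀ (i : Fin n) (a : Fin n → A) (b c d : A), IsLUB {b, c} d →
    IsLUB {Ω (Function.update a i b), Ω (Function.update a i c)} (Ω (Function.update a i d))

/-- Difference-restriction algebras equipped with compatibility preserving operators that
interpret the signature `σ`. -/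
structure DRAOp (σ : Signature.{w}) : Type (max (u + 1) w) where
  toDRA : DRA.{u}
  op : ∀ s : σ.Symbol, (Fin (σ.arity s) → toDRA) → toDRA
  isOperator : ∀ s, IsCompatibilityPreservingOperator (op s)

variable {σ : Signature.{w}}

/-- Homomorphisms of difference-restriction algebras with operators. -/
@[ext]
structure DRAOp.Hom (A B : DRAOp.{u, w} σ) where
  toHom : A.toDRA ⟶ B.toDRA
  map_op : ∀ s a, toHom.toFun (A.op s a) = B.op s (fun i => toHom.toFun (a i))

/-- The category of difference-restriction algebras with operators. -/
instance : Category (DRAOp.{u, w} σ) where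
  Hom := DRAOp.Hom
  id _ := ⟨𝟙 _, fun _ _ => rfl⟩
  comp f g := ⟨f.toHom ≫ g.toHom, fun s a =>
    (congrArg g.toHom.toFun (f.map_op s a)).trans (g.map_op s _)⟩

/-- The underlying difference-restriction algebra is finitarily compatibly complete. -/
def DRAOp.FinitarilyCompatiblyComplete : ObjectProperty (DRAOp.{u, w} σ) := fun A =>
  A.toDRA.FinitarilyCompatiblyComplete

/-- `i` is a finitary compatible completion of the algebra with operators `A`. -/
structure DRAOp.IsFinitaryCompatibleCompletion {A C : DRAOp.{u, w} σ} (i : A ⟶ C) : Prop where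
  injective : Function.Injective i.toHom.toFun
  complete : C.FinitarilyCompatiblyComplete
  dense : FiniteJoinDense (Set.range i.toHom.toFun)

/-- The operation on subsets given by an `(n+1)`-ary relation. -/
def relOp {X : Type u} {n : ℕ} (R : (Fin n → X) → X → Prop) (S : Fin n → Set X) : Set X :=
  {y | ∃ x, (∀ i, x i ∈ S i) ∧ R x y}

/-- Points of an étale space are compatible if they are equal or in different fibres. -/
def SpaceMap.CompatiblePoints (E : SpaceMap.{u}) (x y : E.X) : Prop := E.π x = E.π y → x = y

/-- An `(n+1)`-ary relation on an étale space is tight, spectral, and has the compatibility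
property. -/
structure IsAdmissibleRelation (E : SpaceMap.{u}) {n : ℕ} (R : (Fin n → E.X) → E.X → Prop) :
    Prop where
  compatibility : ∀ x x' y y', (∀ i, E.CompatiblePoints (x i) (x' i)) → R x y → R x' y' →
    E.CompatiblePoints y y'
  continuous : ∀ S : Fin n → Set E.X, (∀ i, IsOpen (S i)) → IsOpen (relOp R S)
  spectral : ∀ S : Fin n → Set E.X, (∀ i, IsCompact (S i) ∧ IsOpen (S i)) →
    IsCompact (relOp R S) ∧ IsOpen (relOp R S)
  tight : ∀ x y, (∀ S : Fin n → Set E.X, (∀ i, IsCompact (S i) ∧ IsOpen (S i)) →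
    (∀ i, x i ∈ S i) → y ∈ relOp R S) → R x y

/-- The reverse forth condition. -/
def ReverseForth {X Y : Type u} {n : ℕ} (φ : X →. Y) (R : (Fin n → X) → X → Prop)
    (R' : (Fin n → Y) → Y → Prop) : Prop :=
  ∀ x y x', R x y → (∀ i, x' i ∈ φ (x i)) → ∃ y' ∈ φ y, R' x' y'

/-- The back condition. -/
def Back {X Y : Type u} {n : ℕ} (φ : X →. Y) (R : (Fin n → X) → X → Prop)
    (R' : (Fin n → Y) → Y → Prop) : Prop :=
  ∀ y y' x', y' ∈ φ y → R' x' y' → ∃ x, (∀ i, x' i ∈ φ (x i)) ∧ R x y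

/-- Hausdorff étale spaces with tight spectral relations that have the compatibility property,
indexed by the signature `σ`. -/
structure HausEtOp (σ : Signature.{w}) : Type (max (u + 1) w) where
  toHausEt : HausEt.{u}
  rel : ∀ s : σ.Symbol,
    (Fin (σ.arity s) → toHausEt.toSpaceMap.X) → toHausEt.toSpaceMap.X → Prop
  isAdmissible : ∀ s, IsAdmissibleRelation toHausEt.toSpaceMap (rel s)

/-- Morphisms of Hausdorff étale spaces with relations. -/
@[ext]
structure HausEtOp.Hom (E E' : HausEtOp.{u, w} σ) where
  toHom : E.toHausEt ⟶ E'.toHausEt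
  reverseForth : ∀ s, ReverseForth toHom.toPFun (E.rel s) (E'.rel s)
  back : ∀ s, Back toHom.toPFun (E.rel s) (E'.rel s)

theorem ReverseForth.comp {X Y Z : Type u} {n : ℕ} {φ : X →. Y} {ψ : Y →. Z}
    {R : (Fin n → X) → X → Prop} {R' : (Fin n → Y) → Y → Prop} {R'' : (Fin n → Z) → Z → Prop}
    (hφ : ReverseForth φ R R') (hψ : ReverseForth ψ R' R'') :
    ReverseForth (ψ.comp φ) R R'' := by
  intro x y x'' hR hx
  choose x' hx' hx'' using fun i => mem_comp.1 (hx i)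
  obtain ⟨y', hy', hR'⟩ := hφ x y x' hR hx'
  obtain ⟨y'', hy'', hR''⟩ := hψ x' y' x'' hR' hx''
  exact ⟨y'', mem_comp.2 ⟨y', hy', hy''⟩, hR''⟩

theorem Back.comp {X Y Z : Type u} {n : ℕ} {φ : X →. Y} {ψ : Y →. Z}
    {R : (Fin n → X) → X → Prop} {R' : (Fin n → Y) → Y → Prop} {R'' : (Fin n → Z) → Z → Prop}
    (hφ : Back φ R R') (hψ : Back ψ R' R'') : Back (ψ.comp φ) R R'' := by
  intro y y'' x'' hy hR''
  obtain ⟨y', hy', hy''⟩ := mem_comp.1 hy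
  obtain ⟨x', hx', hR'⟩ := hψ y' y'' x'' hy'' hR''
  obtain ⟨x, hx, hR⟩ := hφ y y' x' hy' hR'
  exact ⟨x, fun i => mem_comp.2 ⟨x' i, hx i, hx' i⟩, hR⟩

theorem ReverseForth.id {X : Type u} {n : ℕ} (R : (Fin n → X) → X → Prop) :
    ReverseForth (PFun.id X) R R := by
  intro x y x' hR hx
  obtain rfl : x' = x := funext fun i => Part.mem_some_iff.1 (hx i)
  exact ⟨y, Part.mem_some _, hR⟩

theorem Back.id {X : Type u} {n : ℕ} (R : (Fin n → X) → X → Prop) :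
    Back (PFun.id X) R R := by
  intro y y' x' hy hR
  obtain rfl := Part.mem_some_iff.1 hy
  exact ⟨x', fun i => Part.mem_some _, hR⟩

/-- The category of Hausdorff étale spaces with relations. -/
instance : Category (HausEtOp.{u, w} σ) where
  Hom := HausEtOp.Hom
  id _ := ⟨𝟙 _, fun _ => ReverseForth.id _, fun _ => Back.id _⟩
  comp f g := ⟨f.toHom ≫ g.toHom, fun s => (f.reverseForth s).comp (g.reverseForth s),
    fun s => (f.back s).comp (g.back s)⟩
  id_comp _ := HausEtOp.Hom.ext (Category.id_comp _)
  comp_id _ := HausEtOp.Hom.ext (Category.comp_id _)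
  assoc _ _ _ := HausEtOp.Hom.ext (Category.assoc _ _ _)

/-- The underlying étale space is locally compact and zero-dimensional. -/
def HausEtOp.LocallyCompactZeroDim : ObjectProperty (HausEtOp.{u, w} σ) := fun E =>
  E.toHausEt.LocallyCompactZeroDim

/-- The relation on maximal filters given by an operation on the algebra. -/
def filterRel {A : DRA.{u}} {n : ℕ} (Ω : (Fin n → A) → A) (μ : Fin n → MaxFilter A)
    (ν : MaxFilter A) : Prop :=
  ∀ a : Fin n → A, (∀ i, a i ∈ μ i) → Ω a ∈ ν

theorem monotone_of_additive {A : DRA.{u}} {n : ℕ} {Ω : (Fin n → A) → A}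
    (hΩ : IsCompatibilityPreservingOperator Ω) {a b : Fin n → A} (hab : ∀ i, a i ≤ b i) :
    Ω a ≤ Ω b := by
  have step : ∀ (i : Fin n) (c : Fin n → A) (d : A), c i ≤ d → Ω c ≤ Ω (Function.update c i d) := by
    intro i c d hd
    have h : IsLUB {c i, d} d := by
      refine ⟨?_, fun z hz => hz (by simp)⟩
      rintro z (rfl | rfl)
      exacts [hd, le_rfl]
    have := (hΩ.additive i c _ _ _ h).1 (Set.mem_insert _ _)
    rwa [Function.update_eq_self] at this
  have key : ∀ s : Finset (Fin n), Ω a ≤ Ω (s.piecewise b a) := by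
    intro s
    induction s using Finset.induction_on with
    | empty => simp
    | insert i s hi ih =>
      rw [Finset.piecewise_insert]
      refine ih.trans (step i _ _ ?_)
      rw [Finset.piecewise_eq_of_notMem _ _ _ hi]
      exact hab i
  simpa using key Finset.univ

theorem MaxFilter.mem_or_mem_of_isLUB {A : DRA.{u}} (ν : MaxFilter A) {x y z : A}
    (h : IsLUB {x, y} z) (hz : z ∈ ν) : x ∈ ν ∨ y ∈ ν := by
  obtain ⟨X, Y, r, hr⟩ := A.representable
  by_contra! hxy
  have h1 : z ⊖ x ∈ ν := ν.diff_mem hz fun hm => hxy.1 ((ν.mem_meet_iff _ _).1 hm).2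
  have h2 : (z ⊖ x) ⊖ y ∈ ν := ν.diff_mem h1 fun hm => hxy.2 ((ν.mem_meet_iff _ _).1 hm).2
  have hx := (hr.le_iff _ _).1 (h.1 (Set.mem_insert x {y}))
  have hy := (hr.le_iff _ _).1 (h.1 (Set.mem_insert_of_mem x rfl : y ∈ ({x, y} : Set A)))
  have h3 : z ≤ z ⊖ ((z ⊖ x) ⊖ y) := by
    refine h.2 ?_
    rintro w (rfl | rfl)
    · rw [hr.le_iff]
      simp only [hr.map_diff]
      exact fun p hp => ⟨hx hp, fun h' => h'.1.2 hp⟩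
    · rw [hr.le_iff]
      simp only [hr.map_diff]
      exact fun p hp => ⟨hy hp, fun h' => h'.2 hp⟩
  rw [hr.le_iff] at h3
  simp only [hr.map_diff] at h3
  refine ν.notMem_of_rep_empty hr ?_ h2
  simp only [hr.map_diff]
  exact Set.eq_empty_of_forall_notMem fun p hp => (h3 hp.1.1).2 hp

/-- A tuple of filters that an operator maps into a maximal filter extends to a tuple of maximal
filters with the same property. -/
theorem exists_maxFilters {A : DRA.{u}} {n : ℕ} {Ω : (Fin n → A) → A}
    (hΩ : IsCompatibilityPreservingOperator Ω) (ν : MaxFilter A) (F : Fin n → Set A)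
    (hF : ∀ i, Order.IsPFilter (F i)) (hFν : ∀ a : Fin n → A, (∀ i, a i ∈ F i) → Ω a ∈ ν) :
    ∃ μ : Fin n → MaxFilter A, (∀ i, ∀ a ∈ F i, a ∈ μ i) ∧ filterRel Ω μ ν := by
  obtain ⟨X, Y, r, hr⟩ := A.representable
  let s : Set (Fin n → Set A) :=
    {G | (∀ i, Order.IsPFilter (G i)) ∧ ∀ a : Fin n → A, (∀ i, a i ∈ G i) → Ω a ∈ ν}
  have hub : ∀ c ⊆ s, IsChain (· ≤ ·) c → ∀ y ∈ c, ∃ ub ∈ s, ∀ z ∈ c, z ≤ ub := by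
    intro c hc hchain G₀ hG₀
    refine ⟨fun i => ⋃ G ∈ c, G i, ⟨fun i => ?_, fun a ha => ?_⟩, fun G hG i x hx =>
      Set.mem_iUnion₂.2 ⟨G, hG, hx⟩⟩
    · refine (isPFilter_iff _).2 ⟨?_, ?_, ?_⟩
      · obtain ⟨x, hx⟩ := ((isPFilter_iff _).1 ((hc hG₀).1 i)).1
        exact ⟨x, Set.mem_iUnion₂.2 ⟨G₀, hG₀, hx⟩⟩
      · intro x hx y hxy
        obtain ⟨G, hG, hx⟩ := Set.mem_iUnion₂.1 hx
        exact Set.mem_iUnion₂.2 ⟨G, hG, ((isPFilter_iff _).1 ((hc hG).1 i)).2.1 x hx y hxy⟩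
      · intro x hx y hy
        obtain ⟨G, hG, hx⟩ := Set.mem_iUnion₂.1 hx
        obtain ⟨G', hG', hy⟩ := Set.mem_iUnion₂.1 hy
        obtain ⟨H, hH, h1, h2⟩ := hchain.directedOn G hG G' hG'
        exact Set.mem_iUnion₂.2 ⟨H, hH,
          ((isPFilter_iff _).1 ((hc hH).1 i)).2.2 x (h1 i hx) y (h2 i hy)⟩
    · choose G hG hGa using fun i => Set.mem_iUnion₂.1 (ha i)
      have key : ∀ t : Finset (Fin n), ∃ H ∈ c, ∀ i ∈ t, G i ≤ H := by
        intro t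
        induction t using Finset.induction_on with
        | empty => exact ⟨G₀, hG₀, by simp⟩
        | insert i t _ ih =>
          obtain ⟨H, hH, h⟩ := ih
          obtain ⟨K, hK, h1, h2⟩ := hchain.directedOn H hH (G i) (hG i)
          refine ⟨K, hK, fun j hj => ?_⟩
          rcases Finset.mem_insert.1 hj with rfl | hj
          exacts [h2, (h j hj).trans h1]
      obtain ⟨H, hH, h⟩ := key Finset.univ
      exact (hc hH).2 a fun i => h i (Finset.mem_univ i) i (hGa i)
  obtain ⟨M, hFM, hM⟩ := zorn_le_nonempty₀ s hub F ⟨hF, hFν⟩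
  have hup : ∀ i, ∀ a ∈ M i, ∀ b, a ≤ b → b ∈ M i := fun i =>
    ((isPFilter_iff _).1 (hM.prop.1 i)).2.1
  have hmeet : ∀ i, ∀ a ∈ M i, ∀ b ∈ M i, meet a b ∈ M i := fun i =>
    ((isPFilter_iff _).1 (hM.prop.1 i)).2.2
  choose p hp using fun i => ((isPFilter_iff _).1 (hM.prop.1 i)).1
  have upd : ∀ (i : Fin n) (c : Fin n → A) (d : A), (∀ j, c j ∈ M j) → d ∈ M i →
      ∀ j, Function.update c i d j ∈ M j := by
    intro i c d hc hd j
    by_cases hj : j = i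
    · subst hj
      rwa [Function.update_self]
    · rw [Function.update_of_ne hj]
      exact hc j
  have ext : ∀ (i : Fin n) (a e : A), a ∈ M i → meet a e ∉ M i →
      ∃ g : Fin n → A, (∀ j, g j ∈ M j) ∧ Ω (Function.update g i (meet (g i) e)) ∉ ν := by
    intro i a e ha he
    by_contra! hcon
    let N := Function.update M i {x | ∃ f ∈ M i, meet f e ≤ x}
    have hN : N ∈ s := by
      refine ⟨fun j => ?_, fun f hf => ?_⟩
      · by_cases hj : j = i
        · subst hj
          simp only [N, Function.update_self]
          refine (isPFilter_iff _).2 ⟨⟨_, a, ha, le_rfl⟩, ?_, ?_⟩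
          · rintro x ⟨f, hf, hx⟩ y hxy
            exact ⟨f, hf, hx.trans hxy⟩
          · rintro x ⟨f, hf, hx⟩ y ⟨g, hg, hy⟩
            refine ⟨meet f g, hmeet j f hf g hg, ?_⟩
            rw [hr.le_iff] at hx hy ⊢
            simp only [hr.map_meet] at hx hy ⊢
            exact fun q hq => ⟨hx ⟨hq.1.1, hq.2⟩, hy ⟨hq.1.2, hq.2⟩⟩
        · simp only [N, Function.update_of_ne hj]
          exact hM.prop.1 j
      · have hfi := hf i
        simp only [N, Function.update_self] at hfi
        obtain ⟨g, hg, hgf⟩ := hfi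
        have hfM : ∀ j, Function.update f i g j ∈ M j := by
          intro j
          by_cases hj : j = i
          · subst hj
            rwa [Function.update_self]
          · have := hf j
            simp only [N, Function.update_of_ne hj] at this
            rwa [Function.update_of_ne hj]
        refine ν.up (hcon _ hfM) (monotone_of_additive hΩ fun j => ?_)
        by_cases hj : j = i
        · subst hj
          simpa using hgf
        · simp [Function.update_of_ne hj]
    have hMN : M ≤ N := by
      intro j
      by_cases hj : j = i
      · subst hj
        simp only [N, Function.update_self]
        exact fun f hf => ⟨f, hf, (hr.le_iff _ _).2
          (by rw [hr.map_meet]; exact Set.inter_subset_left)⟩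
      · simp only [N, Function.update_of_ne hj]
        exact le_rfl
    have : meet a e ∈ N i := by
      simp only [N, Function.update_self]
      exact ⟨a, ha, le_rfl⟩
    exact he (hM.le_of_ge hN hMN i this)
  have hmax : ∀ i, Maximal (fun F : Set A => Order.IsPFilter F ∧ F ≠ Set.univ) (M i) := by
    intro i
    refine maximal_of_prime (hM.prop.1 i) ?_ ?_
    · intro b hb
      have h1 := hM.prop.2 _ (upd i p _ hp hb)
      have h2 : IsBot (Ω (Function.update p i (b ⊖ b))) := by
        refine hΩ.normal i _ fun z => (hr.le_iff _ _).2 ?_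
        rw [Function.update_self, hr.map_diff, Set.sdiff_self]
        exact Set.empty_subset _
      exact ν.diff_self_notMem b (ν.up h1 (h2 _))
    · intro a ha b
      by_contra! hab
      have e1 : meet a (a ⊖ b) = a ⊖ b := hr.injective (by
        rw [hr.map_meet, hr.map_diff]
        exact Set.inter_eq_right.2 Set.sdiff_subset)
      obtain ⟨g, hg, hgν⟩ := ext i a b ha hab.1
      obtain ⟨g', hg', hgν'⟩ := ext i a (a ⊖ b) ha (by rw [e1]; exact hab.2)
      let m : Fin n → A := Function.update (fun j => meet (g j) (g' j)) i
        (meet (meet (g i) (g' i)) a)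
      have hm : ∀ j, m j ∈ M j := upd i _ _ (fun j => hmeet j _ (hg j) _ (hg' j))
        (hmeet i _ (hmeet i _ (hg i) _ (hg' i)) _ ha)
      have hmi : m i = meet (meet (g i) (g' i)) a := Function.update_self ..
      have hlub : IsLUB {meet (m i) b, meet (m i) (a ⊖ b)} (m i) := by
        constructor
        · rintro z (rfl | rfl) <;>
          exact (hr.le_iff _ _).2 (by rw [hr.map_meet]; exact Set.inter_subset_left)
        · intro z hz
          have h1 := (hr.le_iff _ _).1 (hz (Set.mem_insert _ _))
          have h2 := (hr.le_iff _ _).1 (hz (Set.mem_insert_of_mem _ rfl))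
          rw [hr.le_iff]
          rw [hmi] at h1 h2 ⊢
          simp only [hr.map_meet, hr.map_diff] at h1 h2 ⊢
          intro q hq
          by_cases hqb : q ∈ r b
          · exact h1 ⟨hq, hqb⟩
          · exact h2 ⟨hq, hq.2, hqb⟩
      have hadd := hΩ.additive i m _ _ _ hlub
      rw [Function.update_eq_self] at hadd
      have le : ∀ (k : Fin n → A) (e : A), (∀ j, r (meet (g j) (g' j)) ⊆ r (k j)) →
          Ω (Function.update m i (meet (m i) e)) ≤ Ω (Function.update k i (meet (k i) e)) := by
        intro k e hk
        refine monotone_of_additive hΩ fun j => (hr.le_iff _ _).2 ?_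
        by_cases hj : j = i
        · subst hj
          rw [Function.update_self, Function.update_self, hmi]
          have := hk j
          simp only [hr.map_meet] at this ⊢
          exact fun q hq => ⟨this hq.1.1, hq.2⟩
        · rw [Function.update_of_ne hj, Function.update_of_ne hj]
          simp only [m, Function.update_of_ne hj]
          exact hk j
      rcases ν.mem_or_mem_of_isLUB hadd (hM.prop.2 m hm) with h | h
      · refine hgν (ν.up h (le g b fun j => ?_))
        rw [hr.map_meet]
        exact Set.inter_subset_left
      · refine hgν' (ν.up h (le g' (a ⊖ b) fun j => ?_))
        rw [hr.map_meet]
        exact Set.inter_subset_right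
  exact ⟨fun i => ⟨M i, hmax i⟩, fun i a ha => hFM i ha, hM.prop.2⟩

theorem relOp_mono {X : Type u} {n : ℕ} (R : (Fin n → X) → X → Prop) {S T : Fin n → Set X}
    (h : ∀ i, S i ⊆ T i) : relOp R S ⊆ relOp R T :=
  fun _ ⟨x, hx, hR⟩ => ⟨x, fun i => h i (hx i), hR⟩

theorem relOp_hat {A : DRA.{u}} {n : ℕ} {Ω : (Fin n → A) → A}
    (hΩ : IsCompatibilityPreservingOperator Ω) (a : Fin n → A) :
    relOp (filterRel Ω) (fun i => hat (a i)) = hat (Ω a) := by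
  obtain ⟨X, Y, r, hr⟩ := A.representable
  ext ν
  constructor
  · rintro ⟨μ, hμ, hR⟩
    exact hR a hμ
  · intro hν
    have hF : ∀ i, Order.IsPFilter (Set.Ici (a i)) := by
      refine fun i => (isPFilter_iff _).2 ⟨⟨a i, Set.self_mem_Ici⟩,
        fun b hb c hbc => le_trans hb hbc, fun b hb c hc => ?_⟩
      rw [Set.mem_Ici, hr.le_iff] at hb hc ⊢
      rw [hr.map_meet]
      exact Set.subset_inter hb hc
    obtain ⟨μ, hμ, hR⟩ := exists_maxFilters hΩ ν (fun i => Set.Ici (a i)) hF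
      (fun b hb => ν.up hν (monotone_of_additive hΩ hb))
    exact ⟨μ, fun i => hμ i _ Set.self_mem_Ici, hR⟩

/-- The relation given by a compatibility preserving operator is tight, spectral, and has the
compatibility property. -/
theorem filterRel_isAdmissible {A : DRA.{u}} {n : ℕ} {Ω : (Fin n → A) → A}
    (hΩ : IsCompatibilityPreservingOperator Ω) :
    IsAdmissibleRelation (filterSpace A) (filterRel Ω) := by
  have hcont : ∀ S : Fin n → Set (MaxFilter A), (∀ i, IsOpen (S i)) →
      IsOpen (relOp (filterRel Ω) S) := by
    intro S hS
    rw [isOpen_iff_forall_mem_open]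
    rintro ν ⟨μ, hμ, hR⟩
    choose a ha haS using fun i => exists_hat_subset (hS i) (hμ i)
    refine ⟨hat (Ω a), ?_, isOpen_hat _, hR a ha⟩
    rw [← relOp_hat hΩ]
    exact relOp_mono _ haS
  refine ⟨?_, hcont, ?_, ?_⟩
  · intro (μ : Fin n → MaxFilter A) (μ' : Fin n → MaxFilter A) (ν : MaxFilter A)
      (ν' : MaxFilter A) hC hR hR' e
    have e : ν ≈ ν' := Quotient.exact e
    have : ∀ i, ∃ a ∈ μ i, ∃ b ∈ μ' i, Compatible a b := by
      intro i
      by_cases h : μ i ≈ μ' i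
      · have : μ i = μ' i := hC i (Quotient.sound h)
        obtain ⟨a, ha⟩ := (μ i).exists_mem
        exact ⟨a, ha, a, this ▸ ha, rfl⟩
      · obtain ⟨a, ha, b, hb, h1, h2⟩ := exists_of_not_equiv h
        exact ⟨a, ha, b, hb, h1.trans h2.symm⟩
    choose a ha b hb hab using this
    have hc : Ω a ⊳ Ω b = Ω b ⊳ Ω a := hΩ.compatibility_preserving a b hab
    have := e _ (hR a ha) _ (hR' b hb)
    exact eq_of_equiv e (hc ▸ this.2) this.1
  · intro (S : Fin n → Set (MaxFilter A)) hS
    refine ⟨?_, hcont S fun i => (hS i).2⟩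
    choose t ht hSt using fun i => eq_finite_iUnion_of_isTopologicalBasis_of_isCompact_open
      hat (isTopologicalBasis_hat A) (S i) (hS i).1 (hS i).2
    have : relOp (filterRel Ω) S = ⋃ a ∈ Set.pi Set.univ t, hat (Ω a) := by
      ext ν
      constructor
      · rintro ⟨μ, hμ, hR⟩
        have : ∀ i, ∃ a ∈ t i, a ∈ μ i := fun i => by
          have := hμ i
          rw [hSt i] at this
          obtain ⟨a, ha, h⟩ := Set.mem_iUnion₂.1 this
          exact ⟨a, ha, h⟩
        choose a ha haμ using this
        exact Set.mem_iUnion₂.2 ⟨a, fun i _ => ha i, hR a haμ⟩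
      · intro h
        obtain ⟨a, ha, h⟩ := Set.mem_iUnion₂.1 h
        rw [← relOp_hat hΩ] at h
        refine relOp_mono _ (fun i => ?_) h
        rw [hSt i]
        exact Set.subset_biUnion_of_mem (u := fun a => hat a) (ha i trivial)
    have hc : IsCompact (⋃ a ∈ Set.pi Set.univ t, hat (Ω a)) :=
      (Set.Finite.pi ht).isCompact_biUnion fun a _ => isCompact_hat _
    exact this ▸ hc
  · intro μ ν h a ha
    have := h (fun i => hat (a i)) (fun i => ⟨isCompact_hat _, isOpen_hat _⟩) ha
    exact (relOp_hat hΩ a).subset this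

theorem filterMap_reverseForth {A B : DRAOp.{u, w} σ} (h : A ⟶ B) (s : σ.Symbol) :
    ReverseForth (filterMap h.toHom) (filterRel (B.op s)) (filterRel (A.op s)) := by
  intro ν ν' μ hR hμ
  have key : ∀ a, (∀ i, a i ∈ μ i) → h.toHom.toFun (A.op s a) ∈ ν' := by
    intro a ha
    rw [h.map_op]
    exact hR _ fun i => (mem_filterMap.1 (hμ i) _).1 (ha i)
  choose a ha using fun i => (μ i).exists_mem
  exact ⟨⟨_, maximal_preimage h.toHom ν' ⟨_, key a ha⟩⟩, ⟨⟨_, key a ha⟩, rfl⟩, key⟩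

theorem filterMap_back {A B : DRAOp.{u, w} σ} (h : A ⟶ B) (s : σ.Symbol) :
    Back (filterMap h.toHom) (filterRel (B.op s)) (filterRel (A.op s)) := by
  obtain ⟨X, Y, r, hr⟩ := B.toDRA.representable
  intro ν μ' μ hμ' hR
  rw [mem_filterMap] at hμ'
  have hF : ∀ i, Order.IsPFilter {b | ∃ a ∈ μ i, h.toHom.toFun a ≤ b} := by
    refine fun i => (isPFilter_iff _).2 ⟨?_, ?_, ?_⟩
    · obtain ⟨a, ha⟩ := (μ i).exists_mem
      exact ⟨_, a, ha, le_rfl⟩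
    · rintro b ⟨a, ha, hab⟩ c hbc
      exact ⟨a, ha, hab.trans hbc⟩
    · rintro b ⟨a, ha, hab⟩ b' ⟨a', ha', hab'⟩
      refine ⟨meet a a', (μ i).meet_mem ha ha', ?_⟩
      rw [hr.le_iff] at hab hab' ⊢
      rw [h.toHom.map_meet, hr.map_meet, hr.map_meet]
      exact Set.inter_subset_inter hab hab'
  obtain ⟨ξ, hξ, hRξ⟩ := exists_maxFilters (B.isOperator s) ν _ hF (fun b hb => by
    choose a ha hab using hb
    refine ν.up ?_ (monotone_of_additive (B.isOperator s) hab)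
    rw [← h.map_op]
    exact (hμ' _).1 (hR a ha))
  refine ⟨ξ, fun i => ?_, hRξ⟩
  have h1 : ∀ a ∈ μ i, h.toHom.toFun a ∈ ξ i := fun a ha => hξ i _ ⟨a, ha, le_rfl⟩
  obtain ⟨a, ha⟩ := (μ i).exists_mem
  have : μ i = ⟨_, maximal_preimage h.toHom (ξ i) ⟨a, h1 a ha⟩⟩ := MaxFilter.ext_of_le h1
  rw [this]
  exact ⟨⟨a, h1 a ha⟩, rfl⟩

/-- The functor from difference-restriction algebras with operators to Hausdorff étale spaces with
relations, extending `functorF`. -/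
def functorFOp : DRAOp.{u, w} σ ⥤ (HausEtOp.{u, w} σ)ᵒᵖ where
  obj A := op ⟨(functorF.obj A.toDRA).unop, fun s => filterRel (A.op s),
    fun s => filterRel_isAdmissible (A.isOperator s)⟩
  map h := Quiver.Hom.op (HausEtOp.Hom.mk (functorF.map h.toHom).unop
    (filterMap_reverseForth h) (filterMap_back h))
  map_id A := congrArg Quiver.Hom.op (HausEtOp.Hom.ext
    (congrArg Quiver.Hom.unop (functorF.map_id A.toDRA)))
  map_comp h k := congrArg Quiver.Hom.op (HausEtOp.Hom.ext
    (congrArg Quiver.Hom.unop (functorF.map_comp h.toHom k.toHom)))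

/-- The operation on compact open sets on which the étale map is injective given by a relation. -/
def koOp {E : HausEt.{u}} {n : ℕ} {R : (Fin n → E.toSpaceMap.X) → E.toSpaceMap.X → Prop}
    (hR : IsAdmissibleRelation E.toSpaceMap R) (S : Fin n → koAlg E) : koAlg E :=
  ⟨relOp R (fun i => (S i).1),
    (hR.spectral _ fun i => ⟨(S i).2.1, (S i).2.2.1⟩).1,
    (hR.spectral _ fun i => ⟨(S i).2.1, (S i).2.2.1⟩).2, by
      rintro y ⟨x, hx, hy⟩ y' ⟨x', hx', hy'⟩ e
      exact hR.compatibility _ _ _ _ (fun i => (S i).2.2.2 (hx i) (hx' i)) hy hy' e⟩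

theorem ko_le_iff {E : HausEt.{u}} (U V : koAlg E) : U ≤ V ↔ U.1 ⊆ V.1 := by
  refine (Subtype.ext_iff : meet U V = U ↔ (meet U V).1 = U.1).trans ?_
  change U.1 \ (U.1 \ V.1) = U.1 ↔ _
  rw [Set.sdiff_sdiff_right_self, Set.inter_eq_left]

theorem ko_isLUB {E : HausEt.{u}} {U V W : koAlg E} : IsLUB {U, V} W ↔ W.1 = U.1 ∪ V.1 := by
  constructor
  · intro h
    have hU : U.1 ⊆ W.1 := (ko_le_iff U W).1 (h.1 (by simp))
    have hV : V.1 ⊆ W.1 := (ko_le_iff V W).1 (h.1 (by simp))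
    let T : koAlg E := ⟨U.1 ∪ V.1, U.2.1.union V.2.1, U.2.2.1.union V.2.2.1,
      W.2.2.2.mono (Set.union_subset hU hV)⟩
    refine Set.Subset.antisymm ((ko_le_iff W T).1 (h.2 ?_)) (Set.union_subset hU hV)
    rintro Z (rfl | rfl)
    · exact (ko_le_iff Z T).2 Set.subset_union_left
    · exact (ko_le_iff Z T).2 Set.subset_union_right
  · intro h
    refine ⟨?_, fun Z hZ => (ko_le_iff W Z).2 ?_⟩
    · rintro Z (rfl | rfl)
      · exact (ko_le_iff Z W).2 (h ▸ Set.subset_union_left)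
      · exact (ko_le_iff Z W).2 (h ▸ Set.subset_union_right)
    · rw [h]
      exact Set.union_subset ((ko_le_iff U Z).1 (hZ (by simp))) ((ko_le_iff V Z).1 (hZ (by simp)))

theorem ko_compatible_iff {E : HausEt.{u}} (U V : koAlg E) :
    Compatible U V ↔ ∀ x ∈ U.1, ∀ y ∈ V.1, E.toSpaceMap.CompatiblePoints x y := by
  have key : Compatible U V ↔
      E.toSpaceMap.π ⁻¹' (E.toSpaceMap.π '' U.1) ∩ V.1 =
        E.toSpaceMap.π ⁻¹' (E.toSpaceMap.π '' V.1) ∩ U.1 := Subtype.ext_iff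
  rw [key]
  constructor
  · intro h x hx y hy e
    have : y ∈ E.toSpaceMap.π ⁻¹' (E.toSpaceMap.π '' V.1) ∩ U.1 := h ▸ ⟨⟨x, hx, e⟩, hy⟩
    exact U.2.2.2 hx this.2 e
  · intro h
    ext z
    constructor
    · rintro ⟨⟨x, hx, e⟩, hz⟩
      obtain rfl := h x hx z hz e
      exact ⟨⟨x, hz, rfl⟩, hx⟩
    · rintro ⟨⟨x, hx, e⟩, hz⟩
      obtain rfl := h z hz x hx e.symm
      exact ⟨⟨z, hz, rfl⟩, hx⟩

theorem koOp_isOperator {E : HausEt.{u}} {n : ℕ}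
    {R : (Fin n → E.toSpaceMap.X) → E.toSpaceMap.X → Prop}
    (hR : IsAdmissibleRelation E.toSpaceMap R) :
    IsCompatibilityPreservingOperator (koOp hR) where
  compatibility_preserving a a' h := by
    rw [ko_compatible_iff]
    rintro y ⟨x, hx, hy⟩ y' ⟨x', hx', hy'⟩
    exact hR.compatibility _ _ _ _
      (fun i => (ko_compatible_iff _ _).1 (h i) _ (hx i) _ (hx' i)) hy hy'
  normal i a h Z := by
    rw [ko_le_iff]
    rintro y ⟨x, hx, -⟩
    exact ((ko_le_iff _ ⟨∅, by simp⟩).1 (h _) (hx i)).elim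
  additive i a b c d h := by
    rw [ko_isLUB] at h ⊢
    ext y
    constructor
    · rintro ⟨x, hx, hy⟩
      have hxi : x i ∈ (Function.update a i d i).1 := hx i
      rw [Function.update_self, h] at hxi
      have aux : ∀ e : koAlg E, x i ∈ e.1 → ∀ j, x j ∈ (Function.update a i e j).1 := by
        intro e he j
        by_cases hj : j = i
        · subst hj
          rwa [Function.update_self]
        · have : x j ∈ (Function.update a i d j).1 := hx j
          rwa [Function.update_of_ne hj] at this ⊢
      exact hxi.imp (fun hb => ⟨x, aux b hb, hy⟩) (fun hc => ⟨x, aux c hc, hy⟩)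
    · have aux : ∀ e : koAlg E, e.1 ⊆ d.1 → y ∈ (koOp hR (Function.update a i e)).1 →
          y ∈ (koOp hR (Function.update a i d)).1 := by
        rintro e he ⟨x, hx, hy⟩
        refine ⟨x, fun j => ?_, hy⟩
        have : x j ∈ (Function.update a i e j).1 := hx j
        change x j ∈ (Function.update a i d j).1
        by_cases hj : j = i
        · subst hj
          rw [Function.update_self] at this ⊢
          exact he this
        · rwa [Function.update_of_ne hj] at this ⊢
      rintro (hb | hc)
      · exact aux b (h ▸ Set.subset_union_left) hb
      · exact aux c (h ▸ Set.subset_union_right) hc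

/-- The functor from Hausdorff étale spaces with relations to difference-restriction algebras with
operators, extending `functorG`. -/
def functorGOp : (HausEtOp.{u, w} σ)ᵒᵖ ⥤ DRAOp.{u, w} σ where
  obj E := ⟨functorG.obj (op E.unop.toHausEt), fun s => koOp (E.unop.isAdmissible s),
    fun s => koOp_isOperator (E.unop.isAdmissible s)⟩
  map {E E'} φ := DRAOp.Hom.mk (functorG.map φ.unop.toHom.op) (by
    intro s S
    refine Subtype.ext (Set.ext fun y => ?_)
    constructor
    · rintro ⟨y', ⟨x', hx', hR'⟩, hy⟩
      obtain ⟨x, hx, hR⟩ := φ.unop.back s y y' x' hy hR'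
      exact ⟨x, fun i => ⟨x' i, hx' i, hx i⟩, hR⟩
    · rintro ⟨x, hx, hR⟩
      choose x' hx' hxx' using hx
      obtain ⟨y', hy, hR'⟩ := φ.unop.reverseForth s x y x' hR hxx'
      exact ⟨y', ⟨x', hx', hR'⟩, hy⟩)
  map_id E := DRAOp.Hom.ext (functorG.map_id (op E.unop.toHausEt))
  map_comp φ ψ := DRAOp.Hom.ext (functorG.map_comp φ.unop.toHom.op ψ.unop.toHom.op)

end DiffRestAlg

open DiffRestAlg

universe v₁ u₁

/-! Stone-type duality makes both composites of `functorF` and `functorG` idempotent, and all four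
reflections come from one categorical fact: an endofunctor `T` with unit `η`, taking values in a
full subcategory on whose objects `η` is invertible and satisfying `T η = η T`, is a reflector, the
counit being the inverse of `η`. Each statement therefore needs a natural unit, values in the
subcategory, invertibility there, and the equation `T η = η T`.

On algebras the unit is `a ↦ hat a`. It is injective because every point of a representation yields
a maximal filter (`hat_subset_iff`). The sets `hat a` form a basis, so a compact open set is a
finite union of them; this is finite-join density. If the algebra is finitarily compatibly complete,
the elements `a` occurring in such a union are pairwise compatible and have a join `c`. Maximal
filters are prime for finite joins, so `hat c` is the whole union and the unit is bijective
(`hatHom_surjective`).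

On spaces the unit sends a point to the filter of its compact open neighbourhoods on which the étale
map is injective, and is undefined where there are none. By compactness every maximal filter arises
in this way (`exists_mem_pointMap`). In a locally compact zero-dimensional space these
neighbourhoods form a basis, and the unit is a homeomorphism (`exists_homeomorph_pointMap`).

Each equation `T η = η T` rests on a fact about the other composite: on algebras, that every maximal
filter of compact opens comes from a point; on spaces, that the algebra of an étale space is
complete, so that `hatHom` is onto for it.

Operators and relations ride on the same maps. The algebraic unit preserves operations by
`relOp_hat`. The spatial unit preserves the relations, and tightness is what makes it reflect them
(`rel_of_filterRel`). -/

/-- An idempotent endofunctor with values in a full subcategory on whose objects the unit is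
invertible is a reflector. -/
@[reducible]
noncomputable def reflectiveOfIdempotent {C : Type u₁} [Category.{v₁} C]
    (P : ObjectProperty C) (T : C ⥤ C)
    (hT : ∀ A, P (T.obj A)) (η : 𝟭 C ⟶ T) (hη : ∀ A, P A → IsIso (η.app A))
    (hTη : ∀ A, T.map (η.app A) = η.app (T.obj A)) : Reflective P.ι where
  L := P.lift T hT
  adj := Adjunction.mkOfUnitCounit
    { unit := { app := η.app, naturality := fun _ _ f => η.naturality f }
      counit :=
        { app := fun B => ObjectProperty.homMk (haveI := hη B.obj B.property; inv (η.app B.obj))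
          naturality := fun B B' f => by
            have := hη B.obj B.property
            have := hη B'.obj B'.property
            refine ObjectProperty.hom_ext _ ?_
            change T.map f.hom ≫ inv (η.app B'.obj) = inv (η.app B.obj) ≫ f.hom
            rw [IsIso.comp_inv_eq, Category.assoc, IsIso.eq_inv_comp]
            exact (η.naturality f.hom).symm }
      left_triangle := by
        ext A
        have := hη _ (hT A)
        -- With the counit equal to `η⁻¹`, this triangle is exactly where `T η = η T` is needed; the
        -- other one is only `η ≫ η⁻¹ = 𝟙`.
        change T.map (η.app A) ≫ 𝟙 _ ≫ inv (η.app (T.obj A)) = 𝟙 (T.obj A)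
        rw [Category.id_comp, hTη, IsIso.hom_inv_id]
        rfl
      right_triangle := by
        ext B
        have := hη B.obj B.property
        change η.app B.obj ≫ 𝟙 _ ≫ inv (η.app B.obj) = 𝟙 B.obj
        rw [Category.id_comp, IsIso.hom_inv_id]
        rfl }

namespace DiffRestAlg

/-! ### The completion of an algebra -/

/-- The étale space of maximal filters. -/
abbrev filterEt (A : DRA.{u}) : HausEt.{u} := ⟨filterSpace A, filterSpace_isHausdorffEtale A⟩

theorem hat_diff {A : DRA.{u}} (a b : A) : hat (a ⊖ b) = hat a \ hat b := by
  obtain ⟨X, Y, r, hr⟩ := A.representable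
  ext μ
  constructor
  · intro h
    refine ⟨μ.up h ((hr.le_iff _ _).2 (by rw [hr.map_diff]; exact Set.sdiff_subset)), fun hb =>
      μ.notMem_of_rep_empty hr ?_ (μ.meet_mem h hb)⟩
    rw [hr.map_meet, hr.map_diff]
    exact Set.sdiff_inter_self
  · rintro ⟨ha, hb⟩
    exact μ.diff_mem ha fun h => hb ((μ.mem_meet_iff a b).1 h).2

/-- One inclusion lifts a filter containing `a ⊳ b` to an equivalent filter containing `a`; the
other is the definition of the equivalence. This is what turns algebraic restriction into saturation
along the fibres. -/
theorem hat_rest {A : DRA.{u}} (a b : A) :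
    hat (a ⊳ b) = (filterSpace A).π ⁻¹' ((filterSpace A).π '' hat a) ∩ hat b := by
  obtain ⟨X, Y, r, hr⟩ := A.representable
  ext μ
  constructor
  · intro h
    obtain ⟨ν, hν, e⟩ := exists_equiv_mem h
    exact ⟨⟨ν, hν, Quotient.sound e⟩, μ.up h
      ((hr.le_iff _ _).2 (by rw [hr.map_rest]; exact fun p hp => hp.2))⟩
  · rintro ⟨⟨ν, hν, e⟩, hb⟩
    exact (Quotient.exact e a hν b hb).1

theorem injOn_hat {A : DRA.{u}} (a : A) : Set.InjOn (filterSpace A).π (hat a) :=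
  fun _ hμ _ hν e => eq_of_equiv (Quotient.exact e) hμ hν

/-- The canonical homomorphism into the algebra of the étale space of maximal filters. -/
def hatHom (A : DRA.{u}) : A ⟶ koAlg (filterEt A) where
  toFun a := ⟨hat a, isCompact_hat a, isOpen_hat a, injOn_hat a⟩
  map_diff a b := Subtype.ext (hat_diff a b)
  map_rest a b := Subtype.ext (hat_rest a b)

/-- Enough maximal filters exist because a point `p` of a representation decides membership: the
elements whose graph contains `p` form a prime, hence maximal, filter. A point in `r a` but not in
`r b` would separate `hat a` from `hat b`. -/
theorem hat_subset_iff {A : DRA.{u}} {a b : A} : hat a ⊆ hat b ↔ a ≤ b := by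
  refine ⟨fun h => ?_, fun h μ ha => μ.up ha h⟩
  obtain ⟨X, Y, r, hr⟩ := A.representable
  rw [hr.le_iff]
  intro p hp
  have hmax := maximal_of_prime (A := A) (F := {c | p ∈ r c})
    ((isPFilter_iff _).2 ⟨⟨a, hp⟩, fun c hc d hcd => (hr.le_iff _ _).1 hcd hc, fun c hc d hd => by
      rw [Set.mem_ofPred_eq, hr.map_meet]; exact ⟨hc, hd⟩⟩)
    (fun c hc => by
      rw [Set.mem_ofPred_eq, hr.map_diff] at hc; exact hc.2 hc.1)
    (fun c hc d => by
      simp only [Set.mem_ofPred_eq, hr.map_diff, hr.map_meet] at hc ⊢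
      by_cases hd : p ∈ r d
      exacts [Or.inl ⟨hc, hd⟩, Or.inr ⟨hc, hd⟩])
  exact h (show (⟨_, hmax⟩ : MaxFilter A) ∈ hat a from hp)

theorem hat_injective (A : DRA.{u}) : Function.Injective (hat : A → Set (MaxFilter A)) :=
  fun _ _ h => le_antisymm (hat_subset_iff.1 h.subset) (hat_subset_iff.1 h.superset)

theorem hatHom_injective (A : DRA.{u}) : Function.Injective (hatHom A).toFun :=
  fun _ _ h => hat_injective A (congrArg Subtype.val h)

/-- The union of a finite set of sets that has an upper bound in the algebra is the join. -/
theorem ko_isLUB_of_biUnion {E : HausEt.{u}} {S : Set (koAlg E)} {W : koAlg E}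
    (h : W.1 = ⋃ U ∈ S, U.1) : IsLUB S W := by
  refine ⟨fun U hU => (ko_le_iff U W).2 ?_, fun Z hZ => (ko_le_iff W Z).2 ?_⟩
  · rw [h]
    exact Set.subset_biUnion_of_mem (u := fun U : koAlg E => U.1) hU
  · rw [h]
    exact Set.iUnion₂_subset fun U hU => (ko_le_iff U Z).1 (hZ hU)

/-- The join is the union. Finiteness keeps it compact, and pairwise compatibility is precisely the
injectivity of the étale map on it. -/
theorem koAlg_complete (E : HausEt.{u}) : (koAlg E).FinitarilyCompatiblyComplete := by
  intro S hS hC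
  refine ⟨⟨⋃ U ∈ S, U.1, hS.isCompact_biUnion fun U _ => U.2.1,
    isOpen_biUnion fun U _ => U.2.2.1, ?_⟩, ko_isLUB_of_biUnion rfl⟩
  intro x hx y hy e
  obtain ⟨U, hU, hx⟩ := Set.mem_iUnion₂.1 hx
  obtain ⟨V, hV, hy⟩ := Set.mem_iUnion₂.1 hy
  exact (ko_compatible_iff U V).1 (hC U hU V hV) x hx y hy e

/-- Compactness against the basis of sets `hat a`. It gives finite-join density of the completion
and is the starting point for surjectivity of the unit. -/
theorem ko_eq_biUnion_hat {A : DRA.{u}} (U : koAlg (filterEt A)) :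
    ∃ T : Set A, T.Finite ∧ U.1 = ⋃ a ∈ T, hat a :=
  eq_finite_iUnion_of_isTopologicalBasis_of_isCompact_open hat (isTopologicalBasis_hat A)
    U.1 U.2.1 U.2.2.1

theorem hatHom_isFinitaryCompatibleCompletion (A : DRA.{u}) :
    DRA.IsFinitaryCompatibleCompletion (hatHom A) where
  injective := hatHom_injective A
  complete := koAlg_complete _
  dense U := by
    obtain ⟨T, hT, hU⟩ := ko_eq_biUnion_hat U
    refine ⟨(hatHom A).toFun '' T, Set.image_subset_range _ _, hT.image _,
      ko_isLUB_of_biUnion ?_⟩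
    rw [Set.biUnion_image]
    exact hU

/-! ### Invertibility of the unit on complete algebras -/

/-- Maximal filters are prime with respect to finite joins. -/
theorem MaxFilter.exists_mem_of_isLUB {A : DRA.{u}} (ν : MaxFilter A) {T : Set A}
    (hT : T.Finite) {c : A} (h : IsLUB T c) (hc : c ∈ ν) : ∃ a ∈ T, a ∈ ν := by
  obtain ⟨X, Y, r, hr⟩ := A.representable
  by_contra! hTν
  -- If no member of `T` lies in `ν`, they can be subtracted from `c` one at a time without leaving
  -- `ν`. The resulting `d` is disjoint from all of `T`, so `c ⊖ d` is still an upper bound of `T`,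
  -- which forces `c ≤ c ⊖ d`.
  have key : ∃ d ∈ ν, ∀ a ∈ T, r d ∩ r a = ∅ := by
    -- The induction varies `T`, while `c` need not be the join of the smaller sets.
    clear h
    induction T, hT using Set.Finite.induction_on with
    | empty => exact ⟨c, hc, by simp⟩
    | @insert b T _ _ ih =>
      obtain ⟨d, hd, hdT⟩ := ih fun a ha => hTν a (Set.mem_insert_of_mem _ ha)
      refine ⟨d ⊖ b, ν.diff_mem hd fun hm =>
        hTν b (Set.mem_insert _ _) ((ν.mem_meet_iff _ _).1 hm).2, ?_⟩
      rintro a (rfl | ha)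
      · rw [hr.map_diff, Set.sdiff_inter_self]
      · rw [hr.map_diff]
        exact Set.subset_eq_empty (Set.inter_subset_inter_left _ Set.sdiff_subset) (hdT a ha)
  obtain ⟨d, hd, hdT⟩ := key
  have h1 : c ≤ c ⊖ d := h.2 fun a ha => by
    have hac := (hr.le_iff _ _).1 (h.1 ha)
    rw [hr.le_iff, hr.map_diff]
    exact fun p hp => ⟨hac hp, fun hpd => (hdT a ha).subset ⟨hpd, hp⟩⟩
  have h2 : c ⊖ d ∈ ν := ν.up hc h1
  have h3 : ν ∈ hat c \ hat d := hat_diff c d ▸ h2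
  exact h3.2 hd

theorem hat_eq_biUnion_of_isLUB {A : DRA.{u}} {T : Set A} (hT : T.Finite) {c : A}
    (h : IsLUB T c) : hat c = ⋃ a ∈ T, hat a := by
  ext μ
  simp only [Set.mem_iUnion₂, exists_prop]
  constructor
  · exact fun hμ => μ.exists_mem_of_isLUB hT h hμ
  · rintro ⟨a, ha, hμ⟩
    exact μ.up hμ (h.1 ha)

/-- The finitely many `hat a` that make up a compact open `U` lie inside a set on which the étale
map is injective, so their images are compatible, and injectivity of `hatHom` carries this back to
`A`. Completeness then supplies a join, and primeness shows that its `hat` adds nothing to the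
union. -/
theorem hatHom_surjective {A : DRA.{u}} (hA : A.FinitarilyCompatiblyComplete) :
    Function.Surjective (hatHom A).toFun := by
  intro U
  obtain ⟨T, hT, hU⟩ := ko_eq_biUnion_hat U
  obtain ⟨c, hc⟩ := hA T hT fun a ha b hb => by
    refine hatHom_injective A ?_
    rw [(hatHom A).map_rest, (hatHom A).map_rest]
    refine (ko_compatible_iff _ _).2 fun μ hμ ν hν e => U.2.2.2 ?_ ?_ e
    · rw [hU]; exact Set.mem_biUnion ha hμ
    · rw [hU]; exact Set.mem_biUnion hb hν
  exact ⟨c, Subtype.ext ((hat_eq_biUnion_of_isLUB hT hc).trans hU.symm)⟩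

theorem DRA.isIso_of_bijective {A B : DRA.{u}} (h : A ⟶ B) (hb : Function.Bijective h.toFun) :
    IsIso h := by
  let e := Equiv.ofBijective _ hb
  have he : ∀ b, h.toFun (e.symm b) = b := e.apply_symm_apply
  refine ⟨⟨e.symm, fun a b => hb.1 ?_, fun a b => hb.1 ?_⟩,
    DRA.Hom.ext (funext e.symm_apply_apply), DRA.Hom.ext (funext he)⟩
  · rw [h.map_diff, he, he, he]
  · rw [h.map_rest, he, he, he]

theorem isIso_hatHom {A : DRA.{u}} (hA : A.FinitarilyCompatiblyComplete) : IsIso (hatHom A) :=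
  DRA.isIso_of_bijective _ ⟨hatHom_injective A, hatHom_surjective hA⟩

/-- The canonical homomorphisms form a natural transformation. -/
def hatNatTrans : 𝟭 DRA.{u} ⟶ functorF ⋙ functorG where
  app A := hatHom A
  naturality _ _ h := DRA.Hom.ext (funext fun a => Subtype.ext (preimage_filterMap_hat h a).symm)

/-! ### The space of maximal filters of the algebra of an étale space -/

/-- For each `V`, the point `x` lies either in `V` or outside it, which gives the primeness
criterion. The hypothesis supplies nonemptiness, which can fail when the space is not locally
compact and zero-dimensional; hence `pointMap` is partial. -/
theorem maximal_point {E : HausEt.{u}} {x : E.toSpaceMap.X} (hx : ∃ U : koAlg E, x ∈ U.1) :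
    Maximal (fun F : Set (koAlg E) => Order.IsPFilter F ∧ F ≠ Set.univ) {U | x ∈ U.1} := by
  refine maximal_of_prime ((isPFilter_iff _).2 ⟨hx, fun U hU V hUV => (ko_le_iff U V).1 hUV hU,
    fun U hU V hV => ?_⟩) (fun U hU => hU.2 hU.1) fun U hU V => ?_
  · exact ⟨hU, fun h => h.2 hV⟩
  · by_cases hV : x ∈ V.1
    · exact Or.inl ⟨hU, fun h => h.2 hV⟩
    · exact Or.inr ⟨hU, hV⟩

/-- The partial map sending a point to the maximal filter of its neighbourhoods, where
this filter is nonempty. -/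
def pointMap (E : HausEt.{u}) : E.toSpaceMap.X →. MaxFilter (koAlg E) := fun x =>
  ⟨∃ U : koAlg E, x ∈ U.1, fun hx => ⟨{U | x ∈ U.1}, maximal_point hx⟩⟩

theorem mem_pointMap {E : HausEt.{u}} {x : E.toSpaceMap.X} {μ : MaxFilter (koAlg E)} :
    μ ∈ pointMap E x ↔ ∀ U : koAlg E, U ∈ μ ↔ x ∈ U.1 := by
  constructor
  · rintro ⟨_, rfl⟩ U
    exact Iff.rfl
  · intro h
    obtain ⟨U, hU⟩ := μ.exists_mem
    exact ⟨⟨U, (h U).1 hU⟩, Subtype.ext (Set.ext fun V => (h V).symm)⟩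

/-- One inclusion suffices, since a maximal filter contained in another one equals it. -/
theorem mem_pointMap_of_forall {E : HausEt.{u}} {x : E.toSpaceMap.X} {μ : MaxFilter (koAlg E)}
    (h : ∀ U ∈ μ, x ∈ U.1) : μ ∈ pointMap E x := by
  obtain ⟨U, hU⟩ := μ.exists_mem
  have hx : ∃ U : koAlg E, x ∈ U.1 := ⟨U, h U hU⟩
  exact ⟨hx, (MaxFilter.ext_of_le (ν := ⟨_, maximal_point hx⟩) h).symm⟩

/-- Continuity and properness of `pointMap` reduce to these basic sets. The equation also says that
pulling back along the spatial unit undoes the algebraic unit of `koAlg E`. -/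
theorem preimage_pointMap_hat {E : HausEt.{u}} (U : koAlg E) :
    (pointMap E).preimage (hat U) = U.1 := by
  ext x
  constructor
  · rintro ⟨μ, hU, hμ⟩
    exact (mem_pointMap.1 hμ U).1 hU
  · intro hx
    exact ⟨⟨_, maximal_point ⟨U, hx⟩⟩, hx, ⟨U, hx⟩, rfl⟩

/-- The members of a maximal filter of compact open sets have a common point. -/
theorem exists_mem_pointMap {E : HausEt.{u}} (μ : MaxFilter (koAlg E)) :
    ∃ x, μ ∈ pointMap E x := by
  have := E.isHausdorffEtale.t2
  obtain ⟨U₀, hU₀⟩ := μ.exists_mem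
  have : Nonempty {U : koAlg E // U ∈ μ} := ⟨⟨U₀, hU₀⟩⟩
  obtain ⟨x, hx⟩ := IsCompact.nonempty_iInter_of_directed_nonempty_isCompact_isClosed
    (fun U : {U : koAlg E // U ∈ μ} => U.1.1)
    (fun U V => ⟨⟨_, μ.meet_mem U.2 V.2⟩, fun _ h => h.1, fun _ h => by
      by_contra hV
      exact h.2 ⟨h.1, hV⟩⟩)
    (fun U => by
      by_contra h
      rw [Set.not_nonempty_iff_eq_empty] at h
      have hb : U.1 = U.1 ⊖ U.1 := Subtype.ext (h.trans (Set.sdiff_self (s := U.1.1)).symm)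
      exact μ.diff_self_notMem U.1 (hb ▸ U.2))
    (fun U => U.1.2.1) (fun U => U.1.2.1.isClosed)
  exact ⟨x, mem_pointMap_of_forall fun U hU => Set.mem_iInter.1 hx ⟨U, hU⟩⟩

theorem pointMap_isEtaleMorphism (E : HausEt.{u}) :
    IsEtaleMorphism E.toSpaceMap (filterSpace (koAlg E)) (pointMap E) := by
  have hcont : PContinuous (pointMap E) := by
    intro s hs
    rw [isOpen_iff_forall_mem_open]
    rintro x ⟨μ, hμs, hμ⟩
    obtain ⟨U, hU, hUs⟩ := exists_hat_subset hs hμs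
    refine ⟨U.1, ?_, U.2.2.1, (mem_pointMap.1 hμ U).1 hU⟩
    rw [← preimage_pointMap_hat]
    exact PFun.preimage_mono _ hUs
  have equiv : ∀ {x x' μ μ'}, μ ∈ pointMap E x → μ' ∈ pointMap E x' →
      E.toSpaceMap.π x = E.toSpaceMap.π x' → μ ≈ μ' := by
    intro x x' μ μ' hμ hμ' e U hU V hV
    rw [mem_pointMap] at hμ hμ'
    exact ⟨(hμ' _).2 ⟨⟨x, (hμ U).1 hU, e⟩, (hμ' V).1 hV⟩,
      (hμ _).2 ⟨⟨x', (hμ' V).1 hV, e.symm⟩, (hμ U).1 hU⟩⟩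
  refine ⟨hcont, ?_, ?_, ?_, ?_⟩
  · intro (K : Set (MaxFilter (koAlg E))) (hK : IsCompact (X := MaxFilter (koAlg E)) K)
    have := t2Space_maxFilter (koAlg E)
    obtain ⟨t, ht⟩ := hK.elim_finite_subcover (fun U : koAlg E => hat U) isOpen_hat fun μ _ => by
      obtain ⟨U, hU⟩ := MaxFilter.exists_mem μ
      exact Set.mem_iUnion.2 ⟨U, hU⟩
    have hC : IsCompact (⋃ U ∈ t, U.1) := t.isCompact_biUnion fun U _ => U.2.1
    -- For a partial map the preimage of the complement is not the complement of the preimage. Here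
    -- `pointMap` is defined on every `U`, so within the compact union the two do agree, and
    -- removing an open set leaves a compact one.
    have heq : (pointMap E).preimage K = (⋃ U ∈ t, U.1) \ (pointMap E).preimage Kᶜ := ?_
    · exact heq ▸ hC.diff (hcont Kᶜ hK.isClosed.isOpen_compl)
    ext x
    constructor
    · rintro ⟨μ, hμK, hμ⟩
      refine ⟨?_, fun ⟨ν, hνK, hν⟩ => hνK (Part.mem_unique hμ hν ▸ hμK)⟩
      obtain ⟨U, hUt, hU⟩ := Set.mem_iUnion₂.1 (ht hμK)
      exact Set.mem_iUnion₂.2 ⟨U, hUt, (mem_pointMap.1 hμ U).1 hU⟩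
    · rintro ⟨h1, h2⟩
      obtain ⟨U, -, hU⟩ := Set.mem_iUnion₂.1 h1
      obtain ⟨μ, -, hμ⟩ : x ∈ (pointMap E).preimage (hat U) := by
        rw [preimage_pointMap_hat]; exact hU
      by_contra h3
      exact h2 ⟨μ, fun hμK => h3 ⟨μ, hμK, hμ⟩, hμ⟩
  · intro x x' μ μ' hμ hμ' e
    exact Quotient.sound (equiv hμ hμ' e)
  · intro x x' μ hμ hμ' e
    obtain ⟨U, hU⟩ := MaxFilter.exists_mem μ
    exact U.2.2.2 ((mem_pointMap.1 hμ U).1 hU) ((mem_pointMap.1 hμ' U).1 hU) e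
  · intro x (μ : MaxFilter (koAlg E)) (μ' : MaxFilter (koAlg E)) hμ e
    have e : μ' ≈ μ := Quotient.exact e
    obtain ⟨U, hU⟩ := μ.exists_mem
    obtain ⟨V, hV⟩ := μ'.exists_mem
    -- As `V ⊳ U` belongs to `μ`, the point `x` lies in it, which provides `x'` in `V` on the fibre
    -- of `x`. The filter of `x'` is equivalent to `μ'` and shares the member `V` with it, so the
    -- two coincide.
    obtain ⟨⟨x', hx', e'⟩, -⟩ := (mem_pointMap.1 hμ _).1 (e V hV U hU).1
    have hν : (⟨_, maximal_point ⟨V, hx'⟩⟩ : MaxFilter (koAlg E)) ∈ pointMap E x' :=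
      ⟨⟨V, hx'⟩, rfl⟩
    refine ⟨x', e', ?_⟩
    rwa [eq_of_equiv (Setoid.trans e (Setoid.symm (equiv hν hμ e'))) hV hx']

/-- The canonical morphism from an étale space to the space of maximal filters of its algebra. -/
def pointHom (E : HausEt.{u}) : E ⟶ filterEt (koAlg E) :=
  HausEt.Hom.mk (pointMap E) (pointMap_isEtaleMorphism E)

/-- Together with `mem_comp_pointHom`, this computes the two sides of the naturality square: each
sends `x` to the filter of those elements whose pullback contains `x`. -/
theorem mem_pointHom_comp {E : HausEt.{u}} {A : DRA.{u}} (h : A ⟶ koAlg E)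
    {x : E.toSpaceMap.X} {μ : MaxFilter A} :
    μ ∈ (filterMap h).comp (pointMap E) x ↔ ∀ a, a ∈ μ ↔ x ∈ (h.toFun a).1 := by
  rw [mem_comp]
  constructor
  · rintro ⟨ν, hν, hμ⟩ a
    rw [mem_filterMap.1 hμ, mem_pointMap.1 hν]
  · intro e
    obtain ⟨a, ha⟩ := μ.exists_mem
    have hx : ∃ U : koAlg E, x ∈ U.1 := ⟨_, (e a).1 ha⟩
    exact ⟨⟨_, maximal_point hx⟩, ⟨hx, rfl⟩, mem_filterMap.2 e⟩

theorem mem_comp_pointHom {E E' : HausEt.{u}} (φ : E ⟶ E')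
    {x : E.toSpaceMap.X} {μ : MaxFilter (koAlg E')} :
    μ ∈ (pointMap E').comp φ.toPFun x ↔ ∀ U, U ∈ μ ↔ x ∈ ((koMap φ).toFun U).1 := by
  rw [mem_comp]
  constructor
  · rintro ⟨y, hy, hμ⟩ U
    rw [mem_pointMap.1 hμ]
    exact ⟨fun h => ⟨y, h, hy⟩, fun ⟨z, hz, hzx⟩ => Part.mem_unique hy hzx ▸ hz⟩
  · intro e
    obtain ⟨U, hU⟩ := μ.exists_mem
    obtain ⟨y, -, hy⟩ := (e U).1 hU
    refine ⟨y, hy, mem_pointMap_of_forall fun V hV => ?_⟩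
    obtain ⟨z, hz, hzx⟩ := (e V).1 hV
    exact Part.mem_unique hzx hy ▸ hz

/-- The canonical morphisms form a natural transformation. -/
def pointNatTrans : 𝟭 HausEt.{u} ⟶ functorG.rightOp ⋙ functorF.leftOp where
  app E := pointHom E
  naturality _ _ φ := HausEt.Hom.ext (PFun.ext fun _ _ =>
    (mem_comp_pointHom φ).trans (mem_pointHom_comp (koMap φ)).symm)

/-! ### Locally compact zero-dimensional étale spaces -/

theorem isClopen_hat {A : DRA.{u}} (a : A) : IsClopen (hat a) :=
  have := t2Space_maxFilter A
  ⟨(isCompact_hat a).isClosed, isOpen_hat a⟩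

theorem filterEt_locallyCompactZeroDim (A : DRA.{u}) : (filterEt A).LocallyCompactZeroDim := by
  have key : ∀ μ : MaxFilter A, ∀ U ∈ 𝓝 μ, ∃ a, hat a ∈ 𝓝 μ ∧ hat a ⊆ U := by
    intro μ U hU
    obtain ⟨V, hVU, hV, hμ⟩ := mem_nhds_iff.1 hU
    obtain ⟨a, ha, haV⟩ := exists_hat_subset hV hμ
    exact ⟨a, (isOpen_hat a).mem_nhds ha, haV.trans hVU⟩
  constructor
  · refine ⟨fun μ U hU => ?_⟩
    obtain ⟨a, ha, haU⟩ := key μ U hU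
    exact ⟨hat a, ha, haU, isCompact_hat a⟩
  · intro μ U hU
    obtain ⟨a, ha, haU⟩ := key μ U hU
    exact ⟨hat a, ha, isClopen_hat a, haU⟩

/-- In a locally compact zero-dimensional étale space, the compact open sets on which the étale map
is injective form a basis. -/
theorem exists_ko_subset {E : HausEt.{u}} (hE : E.LocallyCompactZeroDim) {x : E.toSpaceMap.X}
    {W : Set E.toSpaceMap.X} (hW : W ∈ 𝓝 x) : ∃ U : koAlg E, x ∈ U.1 ∧ U.1 ⊆ W := by
  have := hE.1
  obtain ⟨V, hV, hinj⟩ : ∃ V ∈ 𝓝 x, Set.InjOn E.toSpaceMap.π V := by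
    obtain ⟨e, hx, he⟩ := E.isHausdorffEtale.isLocalHomeomorph x
    exact ⟨e.source, e.open_source.mem_nhds hx, he ▸ e.injOn⟩
  -- A clopen neighbourhood inside a compact one is compact open; shrinking into `V` beforehand
  -- makes the étale map injective on it.
  obtain ⟨K, hK, hKV, hKc⟩ := local_compact_nhds (Filter.inter_mem hW hV)
  obtain ⟨U, hU, hUc, hUK⟩ := hE.2 x K hK
  exact ⟨⟨U, hKc.of_isClosed_subset hUc.1 hUK, hUc.2, hinj.mono fun y hy => (hKV (hUK hy)).2⟩,
    mem_of_mem_nhds hU, fun y hy => (hKV (hUK hy)).1⟩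

/-- The inverse of an étale morphism that is a homeomorphism is an étale morphism. -/
theorem isEtaleMorphism_symm {E E' : SpaceMap.{u}} {φ : E.X →. E'.X}
    (hφ : IsEtaleMorphism E E' φ) (e : E.X ≃ₜ E'.X) (he : ∀ x y, y ∈ φ x ↔ e x = y) :
    IsEtaleMorphism E' E (e.symm : E'.X → E.X) where
  continuous s hs := by
    rw [PFun.coe_preimage]; exact hs.preimage e.symm.continuous
  proper K hK := by
    rw [PFun.coe_preimage, ← e.image_eq_preimage_symm]; exact hK.image e.continuous
  preserves_equiv x x' y y' h h' eq := by
    simp only [PFun.coe_val, Part.mem_some_iff] at h h'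
    -- Inversion exchanges two axioms: fibrewise surjectivity of `φ` gives preservation of fibres by
    -- the inverse, and preservation of fibres by `φ` gives fibrewise surjectivity of the inverse.
    obtain ⟨z, hz, hzx⟩ := hφ.fibrewise_surjective (e.symm x) x x' (by simp [he]) eq.symm
    rw [he] at hzx
    rw [h, h', ← hz, ← hzx, e.symm_apply_apply]
  fibrewise_injective x x' y h h' _ := by
    simp only [PFun.coe_val, Part.mem_some_iff] at h h'
    exact e.symm.injective (h.symm.trans h')
  fibrewise_surjective x y y' h eq := by
    simp only [PFun.coe_val, Part.mem_some_iff] at h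
    subst h
    exact ⟨e y', hφ.preserves_equiv y' (e.symm x) _ _ (by simp [he]) (by simp [he]) eq, by simp⟩

/-- A locally compact zero-dimensional étale space is homeomorphic to the space of maximal filters
of its algebra. -/
theorem exists_homeomorph_pointMap {E : HausEt.{u}} (hE : E.LocallyCompactZeroDim) :
    ∃ e : E.toSpaceMap.X ≃ₜ MaxFilter (koAlg E), ∀ x μ, μ ∈ pointMap E x ↔ e x = μ := by
  have := E.isHausdorffEtale.t2
  have hdom : ∀ x, ∃ U : koAlg E, x ∈ U.1 := fun x =>
    (exists_ko_subset hE (x := x) Filter.univ_mem).imp fun _ h => h.1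
  let f : E.toSpaceMap.X → MaxFilter (koAlg E) := fun x => ⟨_, maximal_point (hdom x)⟩
  have hf : ∀ x μ, μ ∈ pointMap E x ↔ f x = μ := fun x μ =>
    ⟨fun ⟨_, h⟩ => h, fun h => ⟨hdom x, h⟩⟩
  have hpre : ∀ s, f ⁻¹' s = (pointMap E).preimage s := fun s => Set.ext fun x =>
    ⟨fun h => ⟨f x, h, (hf x _).2 rfl⟩, fun ⟨μ, hμ, h⟩ =>
      show f x ∈ s from ((hf x μ).1 h).symm ▸ hμ⟩
  have hbij : Function.Bijective f := by
    constructor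
    · intro x y hxy
      by_contra hne
      -- A basic set around `x` that avoids `y` separates the two filters.
      obtain ⟨U, hxU, hU⟩ := exists_ko_subset hE (isOpen_compl_singleton.mem_nhds hne)
      exact hU (show U ∈ f y from hxy ▸ hxU) rfl
    · intro μ
      exact (exists_mem_pointMap μ).imp fun x hx => (hf x μ).1 hx
  refine ⟨(Equiv.ofBijective f hbij).toHomeomorphOfContinuousOpen ?_ ?_, hf⟩
  · exact ⟨fun s hs => by
      change IsOpen (f ⁻¹' s)
      rw [hpre]; exact (pointMap_isEtaleMorphism E).continuous s hs⟩
  · intro s hs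
    rw [isOpen_iff_forall_mem_open]
    rintro _ ⟨x, hx, rfl⟩
    obtain ⟨U, hxU, hU⟩ := exists_ko_subset hE (hs.mem_nhds hx)
    refine ⟨hat U, fun μ hμ => ?_, isOpen_hat U, hxU⟩
    obtain ⟨y, rfl⟩ := hbij.2 μ
    exact ⟨y, hU hμ, rfl⟩

theorem comp_symm_eq_id {X Y : Type u} {φ : X →. Y} (e : X ≃ Y)
    (he : ∀ x y, y ∈ φ x ↔ e x = y) : PFun.comp (e.symm : Y → X) φ = PFun.id X := by
  refine PFun.ext fun x y => mem_comp.trans ?_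
  simp [he, eq_comm]

theorem symm_comp_eq_id {X Y : Type u} {φ : X →. Y} (e : X ≃ Y)
    (he : ∀ x y, y ∈ φ x ↔ e x = y) : φ.comp (e.symm : Y → X) = PFun.id Y := by
  refine PFun.ext fun x y => mem_comp.trans ?_
  simp [he, eq_comm]

theorem isIso_pointHom {E : HausEt.{u}} (hE : E.LocallyCompactZeroDim) : IsIso (pointHom E) := by
  obtain ⟨e, he⟩ := exists_homeomorph_pointMap hE
  exact ⟨HausEt.Hom.mk _ (isEtaleMorphism_symm (pointMap_isEtaleMorphism E) e he),
    HausEt.Hom.ext (comp_symm_eq_id e.toEquiv he), HausEt.Hom.ext (symm_comp_eq_id e.toEquiv he)⟩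

/-! ### Idempotence of the two composites -/

/-- A maximal filter `ξ` of compact opens is the filter of some point `μ`, and pulling `ξ` back
along `hatHom A` recovers `μ`. Both homomorphisms therefore test whether `μ ∈ U`. -/
theorem koMap_filterMap_hatHom (A : DRA.{u}) :
    (functorF ⋙ functorG).map (hatHom A) = hatHom (koAlg (filterEt A)) := by
  refine DRA.Hom.ext (funext fun (U : koAlg (filterEt A)) =>
    Subtype.ext (Set.ext fun (ξ : MaxFilter (koAlg (filterEt A))) => ?_))
  obtain ⟨μ, hμ⟩ := exists_mem_pointMap ξ
  have hμ := mem_pointMap.1 hμ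
  have hμξ : μ ∈ filterMap (hatHom A) ξ := mem_filterMap.2 fun a => (hμ ((hatHom A).toFun a)).symm
  change (∃ ν, ν ∈ U.1 ∧ ν ∈ filterMap (hatHom A) ξ) ↔ U ∈ ξ
  rw [hμ]
  exact ⟨fun ⟨ν, hν, h⟩ => Part.mem_unique h hμξ ▸ hν, fun h => ⟨μ, h, hμξ⟩⟩

/-- Completeness of `koAlg E` makes each compact open `W` on which the étale map is injective of the
form `hat U`, and its preimage under the spatial unit is `U`. Both partial maps then impose the same
condition `U ∈ μ`. -/
theorem filterMap_koMap_pointHom (E : HausEt.{u}) :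
    filterMap (koMap (pointHom E)) = pointMap (filterEt (koAlg E)) := by
  refine PFun.ext fun μ ξ => ?_
  refine mem_filterMap.trans
    (Iff.trans (forall_congr' fun W => iff_congr Iff.rfl ?_) mem_pointMap.symm)
  obtain ⟨U, rfl⟩ := hatHom_surjective (koAlg_complete E) W
  have : (koMap (pointHom E)).toFun ((hatHom (koAlg E)).toFun U) = U :=
    Subtype.ext (preimage_pointMap_hat U)
  rw [this]
  rfl

/-! ### Operators and relations -/

variable {σ : Signature.{w}}

/-- The canonical homomorphisms of algebras with operators form a natural transformation. -/
def hatNatTransOp : 𝟭 (DRAOp.{u, w} σ) ⟶ functorFOp ⋙ functorGOp where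
  app A := DRAOp.Hom.mk (hatHom A.toDRA) fun s a =>
    Subtype.ext (relOp_hat (A.isOperator s) a).symm
  naturality _ _ h := DRAOp.Hom.ext (hatNatTrans.naturality h.toHom)

theorem DRAOp.isIso_of_bijective {A B : DRAOp.{u, w} σ} (h : A ⟶ B)
    (hb : Function.Bijective h.toHom.toFun) : IsIso h := by
  obtain ⟨k, hk, hk'⟩ := DRA.isIso_of_bijective h.toHom hb
  have hkb : ∀ b, h.toHom.toFun (k.toFun b) = b := fun b => congrFun (congrArg DRA.Hom.toFun hk') b
  refine ⟨DRAOp.Hom.mk k fun s b => hb.1 ?_, DRAOp.Hom.ext hk, DRAOp.Hom.ext hk'⟩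
  rw [h.map_op, hkb]
  exact congrArg _ (funext fun i => (hkb (b i)).symm)

/-- If each `x i` has a neighbourhood in the algebra, the operation applied to these neighbourhoods
is an element of the algebra containing `y`. So `pointMap` is defined at `y`. -/
theorem pointMap_reverseForth {E : HausEt.{u}} {n : ℕ}
    {R : (Fin n → E.toSpaceMap.X) → E.toSpaceMap.X → Prop}
    (hR : IsAdmissibleRelation E.toSpaceMap R) :
    ReverseForth (pointMap E) R (filterRel (koOp hR)) := by
  intro x y μ hxy hμ
  have key : ∀ U : Fin n → koAlg E, (∀ i, U i ∈ μ i) → y ∈ (koOp hR U).1 := fun U hU =>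
    ⟨x, fun i => (mem_pointMap.1 (hμ i) _).1 (hU i), hxy⟩
  choose U hU using fun i => (μ i).exists_mem
  have hy : ∃ U : koAlg E, y ∈ U.1 := ⟨_, key U hU⟩
  exact ⟨⟨_, maximal_point hy⟩, ⟨hy, rfl⟩, key⟩

/-- This is where tightness enters: the relation on filters controls all compact open neighbourhoods
of the `x i`, and tightness recovers the relation on points from them. -/
theorem rel_of_filterRel {E : HausEt.{u}} {n : ℕ}
    {R : (Fin n → E.toSpaceMap.X) → E.toSpaceMap.X → Prop}
    (hR : IsAdmissibleRelation E.toSpaceMap R) {x : Fin n → E.toSpaceMap.X}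
    {y : E.toSpaceMap.X} {μ : Fin n → MaxFilter (koAlg E)} {ν : MaxFilter (koAlg E)}
    (hμ : ∀ i, μ i ∈ pointMap E (x i)) (hν : ν ∈ pointMap E y)
    (h : filterRel (koOp hR) μ ν) : R x y := by
  refine hR.tight x y fun S hS hxS => ?_
  have := E.isHausdorffEtale.t2
  choose U hU using fun i => (μ i).exists_mem
  -- Tightness quantifies over all compact open sets, but elements of the algebra must also have
  -- injective étale map. Intersecting with a member of `μ i` repairs this.
  let V : Fin n → koAlg E := fun i => ⟨S i ∩ (U i).1, (hS i).1.inter (U i).2.1,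
    (hS i).2.inter (U i).2.2.1, (U i).2.2.2.mono Set.inter_subset_right⟩
  have hV := h V fun i => (mem_pointMap.1 (hμ i) _).2
    ⟨hxS i, (mem_pointMap.1 (hμ i) _).1 (hU i)⟩
  exact relOp_mono R (fun i => Set.inter_subset_left) ((mem_pointMap.1 hν _).1 hV)

theorem pointMap_back {E : HausEt.{u}} {n : ℕ}
    {R : (Fin n → E.toSpaceMap.X) → E.toSpaceMap.X → Prop}
    (hR : IsAdmissibleRelation E.toSpaceMap R) :
    Back (pointMap E) R (filterRel (koOp hR)) := by
  intro y ν μ hν h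
  choose x hx using fun i => exists_mem_pointMap (μ i)
  exact ⟨x, hx, rel_of_filterRel hR hx hν h⟩

/-- The canonical morphisms of étale spaces with relations form a natural transformation. -/
def pointNatTransOp :
    𝟭 (HausEtOp.{u, w} σ) ⟶ functorGOp.rightOp ⋙ functorFOp.leftOp where
  app E := HausEtOp.Hom.mk (pointHom E.toHausEt)
    (fun s => pointMap_reverseForth (E.isAdmissible s)) fun s => pointMap_back (E.isAdmissible s)
  naturality _ _ φ := HausEtOp.Hom.ext (pointNatTrans.naturality φ.toHom)

/-- A relational inverse needs more than bijectivity. Since `pointMap` is a homeomorphism here,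
`rel_of_filterRel` gives the reverse forth condition for the inverse, and `pointMap_reverseForth`
gives its back condition. -/
theorem isIso_pointNatTransOp_app {E : HausEtOp.{u, w} σ}
    (hE : E.toHausEt.LocallyCompactZeroDim) : IsIso (pointNatTransOp.app E) := by
  obtain ⟨e, he⟩ := exists_homeomorph_pointMap hE
  refine ⟨HausEtOp.Hom.mk
      (HausEt.Hom.mk _ (isEtaleMorphism_symm (pointMap_isEtaleMorphism E.toHausEt) e he))
      (fun s => ?_) fun s => ?_,
    HausEtOp.Hom.ext (HausEt.Hom.ext (comp_symm_eq_id e.toEquiv he)),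
    HausEtOp.Hom.ext (HausEt.Hom.ext (symm_comp_eq_id e.toEquiv he))⟩
  · intro μ ν x h hx
    refine ⟨e.symm ν, Part.mem_some _, rel_of_filterRel (E.isAdmissible s) (fun i => (he _ _).2 ?_)
      ((he _ _).2 (e.apply_symm_apply ν)) h⟩
    exact (congrArg e (Part.mem_some_iff.1 (hx i))).trans (e.apply_symm_apply (μ i))
  · intro ν y x hy hxy
    have hy := Part.mem_some_iff.1 hy
    obtain ⟨ν', hν', h⟩ := pointMap_reverseForth (E.isAdmissible s) x y (fun i => e (x i)) hxy
      fun i => (he _ _).2 rfl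
    have : ν = ν' := by
      rw [← (he _ _).1 hν', hy]
      exact (e.apply_symm_apply _).symm
    exact ⟨fun i => e (x i), fun i => Part.mem_some_iff.2 (e.symm_apply_apply _).symm, this ▸ h⟩

end DiffRestAlg

/-! ### The four reflections -/

theorem corollary4 :
    (∃ (hGF : ∀ A : DRA.{u},
          DRA.FinitarilyCompatiblyComplete ((functorF ⋙ functorG).obj A))
        (R : Reflective (DRA.FinitarilyCompatiblyComplete.{u}.ι)),
      R.L = DRA.FinitarilyCompatiblyComplete.lift (functorF ⋙ functorG) hGF ∧
        ∀ A : DRA.{u}, DRA.IsFinitaryCompatibleCompletion (R.adj.unit.app A)) ∧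
    (∃ (hFG : ∀ E : HausEt.{u},
          HausEt.LocallyCompactZeroDim ((functorG.rightOp ⋙ functorF.leftOp).obj E))
        (R : Reflective (HausEt.LocallyCompactZeroDim.{u}.ι)),
      R.L = HausEt.LocallyCompactZeroDim.lift (functorG.rightOp ⋙ functorF.leftOp) hFG) ∧
    ∀ σ : Signature.{w},
      (∃ (hGF : ∀ A : DRAOp.{u, w} σ,
            DRAOp.FinitarilyCompatiblyComplete ((functorFOp ⋙ functorGOp).obj A))
          (R : Reflective (DRAOp.FinitarilyCompatiblyComplete.{u, w} (σ := σ)).ι),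
        R.L = DRAOp.FinitarilyCompatiblyComplete.lift (functorFOp ⋙ functorGOp) hGF ∧
          ∀ A : DRAOp.{u, w} σ, DRAOp.IsFinitaryCompatibleCompletion (R.adj.unit.app A)) ∧
      (∃ (hFG : ∀ E : HausEtOp.{u, w} σ,
            HausEtOp.LocallyCompactZeroDim ((functorGOp.rightOp ⋙ functorFOp.leftOp).obj E))
          (R : Reflective (HausEtOp.LocallyCompactZeroDim.{u, w} (σ := σ)).ι),
        R.L = HausEtOp.LocallyCompactZeroDim.lift
          (functorGOp.rightOp ⋙ functorFOp.leftOp) hFG) := by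
  -- The reflector is the lift, and the unit of the adjunction is `η`, by definition; this accounts
  -- for each `rfl` and for reading the completion property of `hatHom` directly as that of the
  -- reflection arrow. With operators or relations, morphisms are determined by their underlying
  -- maps, so `T η = η T` is inherited.
  refine ⟨⟨fun A => koAlg_complete _, reflectiveOfIdempotent _ _ _ hatNatTrans
      (fun A hA => isIso_hatHom hA) koMap_filterMap_hatHom, rfl,
      hatHom_isFinitaryCompatibleCompletion⟩,
    ⟨fun E => filterEt_locallyCompactZeroDim _, reflectiveOfIdempotent _ _ _ pointNatTrans
      (fun E hE => isIso_pointHom hE)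
      (fun E => HausEt.Hom.ext (filterMap_koMap_pointHom E)), rfl⟩,
    fun σ => ⟨⟨fun A => koAlg_complete _, reflectiveOfIdempotent _ _ _ hatNatTransOp
      (fun A hA => DRAOp.isIso_of_bijective _
        ⟨hatHom_injective A.toDRA, hatHom_surjective hA⟩)
      (fun A => DRAOp.Hom.ext (koMap_filterMap_hatHom A.toDRA)), rfl, fun A =>
        have h := hatHom_isFinitaryCompatibleCompletion A.toDRA
        ⟨h.injective, h.complete, h.dense⟩⟩,
    ⟨fun E => filterEt_locallyCompactZeroDim _, reflectiveOfIdempotent _ _ _ pointNatTransOp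
      (fun E hE => isIso_pointNatTransOp_app hE)
      (fun E => HausEtOp.Hom.ext (HausEt.Hom.ext (filterMap_koMap_pointHom E.toHausEt))), rfl⟩⟩⟩
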